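/- **Notation.** Let $[n]=\{1,\dots,n\}$, and for a matrix $B$ let $\|B\|_\infty=\max_{i,j}|B_{ij}|$. Let $M\in\{0,1\}^{n\times n}$ be the causal mask, $M_{ij}=1$ iff $i\ge j$; $\circ$ is the entrywise product, and $\exp$ of a vector or matrix is entrywise. For $a\in\mathbb R^n$ and $m\in[n]$ the sub-convolution matrix $\mathsf{conv}(a,m)\in\mathbb R^{n\times n}$ has the entries $\mathsf{conv}(a,m)_{ij}=a_{i-j+1}$ for $i\ge j\ge n-m+1$ and $0$ otherwise. Let $k,T\in[n]$, $\delta\ge 0$. Vectors $b_1,\dots,b_k\in\mathbb R^n$ and integers $n\ge m_1>m_2>\dots>m_k\ge T$ form a *$(T,\delta)$-non-degenerate $k$-conv basis* if $\big\|\sum_{l=j}^{i}(b_l)_{1:T}\big\|_1\ge\delta$ for all $1\le j\le i\le k$. A matrix $G$ is *$\epsilon$-close* to it if $G=\sum_{i=1}^k\mathsf{conv}(b_i,m_i)+R$ with $\|R\|_\infty\le\epsilon\le\frac{\delta}{5T}$. **Algorithm 1** (input $Q,K,V\in\mathbb R^{n\times d}$, $k,T,\delta,\epsilon$). Write $\widetilde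 H=M\circ(QK^\top)$; its $j$-th column is computed, when needed, as $M_j\circ(Q(K^\top)_j)$. Start with $v=\mathbf 0_T$, $u=\mathbf 0_n$, $s=0$, $t=n-T+1$. For $i=1,\dots,k$: - increase $s$ by $1$, and replace $s$ by $\mathrm{Search}(s,t)$, where $\mathrm{Search}(s,t)=s$ if $s\ge t$, and otherwise, with $j=\lfloor (s+t)/2\rfloor$, $\mathrm{Search}(s,t)=\mathrm{Search}(s,j)$ if $\|(\widetilde H_j)_{j:j+T-1}-v\|_1\ge\delta-2T\epsilon$ and $\mathrm{Search}(s,t)=\mathrm{Search}(j+1,t)$ if not; - put $m'_i=n-s+1$, $(b'_i)_{1:m'_i}=(\widetilde H_s)_{s:n}-u_{1:m'_i}$, and let the other entries of $b'_i$ be $0$; - add $(b'_i)_{1:T}$ to $v$ and $b'_i$ to $u$. Then put $\widetilde b_1=\exp(b'_1)$ and $\widetilde b_r=\exp(\sum_{l\le r}b'_l)-\exp(\sum_{l\le r-1}b'_l)$ for $2\le r\le k$, and return $\widetilde Y=\widetilde D^{-1}\widetilde AV$, where $\widetilde A=\sum_{r=1}^k\mathsf{conv}(\widetilde b_r,m'_r)$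 and $\widetilde D=\mathrm{diag}(\widetilde A\mathbf 1_n)$; each product of a $\mathsf{conv}(\widetilde b_r,m'_r)$ with a vector is computed by fast Fourier transforms. Running time is the number of steps on a real RAM with unit-cost real arithmetic, comparisons, $\exp$, $\sin$, $\cos$ and index operations. **Theorem.** There is an absolute constant $C>0$ such that the following holds. Let $Q,K,V\in\mathbb R^{n\times d}$, $A=M\circ\exp(QK^\top)$, $D=\mathrm{diag}(A\mathbf 1_n)$ and $Y=D^{-1}AV$. Let $M\circ(QK^\top)$ be $\epsilon$-close to a $(T,\delta)$-non-degenerate $k$-conv basis $(b_i,m_i)_{i\in[k]}$ with $m_1=n$, where $k,T\in[n]$, $\epsilon\ge 0$, and $\delta>0$ (the case $\delta=0$ is allowed too when $k=n+1-T$). Then Algorithm 1 on $Q,K,V,k,T,\delta,\epsilon$ produces an invertible $\widetilde D$ and an output $\widetilde Y$ with $$\|Y-\widetilde Y\|_\infty\le 2(\exp(2\epsilon)-1)\|V\|_\infty ,$$ and, if $n\ge 2$ and $d\ge 1$, its running time is at most $C\,k\,n\,d\log n$. -/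

import Mathlib

-- Matrices carry the entrywise maximum norm: `‖A‖ = max_{i,j} |A i j|`.
attribute [local instance] Matrix.normedAddCommGroup

noncomputable section

namespace ConvAttention

/-! ## Attention and sub-convolution matrices

All indices are 0-based: the entry with index `i` here is the `(i+1)`-st one. -/

/-- The causal attention mask: `1` on and below the diagonal, `0` above it. -/
def causalMask (n : ℕ) : Matrix (Fin n) (Fin n) ℝ :=
  Matrix.of fun i j => if j ≤ i then 1 else 0

/-- `H̃ = M ∘ (Q Kᵀ)`. -/
def maskedScores {n d : ℕ} (Q K : Matrix (Fin n) (Fin d) ℝ) : Matrix (Fin n) (Fin n) ℝ :=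
  Matrix.hadamard (causalMask n) (Q * K.transpose)

/-- `A = M ∘ exp (Q Kᵀ)`, with the entrywise exponential. -/
def attnMatrix {n d : ℕ} (Q K : Matrix (Fin n) (Fin d) ℝ) : Matrix (Fin n) (Fin n) ℝ :=
  Matrix.hadamard (causalMask n) ((Q * K.transpose).map Real.exp)

/-- `D = diag (A 1)`. -/
def attnNormalizer {n d : ℕ} (Q K : Matrix (Fin n) (Fin d) ℝ) : Matrix (Fin n) (Fin n) ℝ :=
  Matrix.diagonal ((attnMatrix Q K).mulVec 1)

/-- The exact attention `Y = D⁻¹ A V`. -/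
def exactAttention {n d : ℕ} (Q K V : Matrix (Fin n) (Fin d) ℝ) : Matrix (Fin n) (Fin d) ℝ :=
  (attnNormalizer Q K)⁻¹ * attnMatrix Q K * V

/-- The sub-convolution matrix `conv(a, m)`, for `m ≤ n`: the lower right `m × m` block is the
lower triangular Toeplitz matrix with first column `a_1, …, a_m`, everything else is zero. -/
def subConv {n : ℕ} (a : Fin n → ℝ) (m : ℕ) : Matrix (Fin n) (Fin n) ℝ :=
  Matrix.of fun i j =>
    if n - m ≤ (j : ℕ) ∧ j ≤ i then a ⟨i - j, lt_of_le_of_lt (Nat.sub_le _ _) i.isLt⟩ else 0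

/-- `b_1, …, b_k` and `n ≥ m_1 > ⋯ > m_k ≥ T` form a `(T, δ)`-non-degenerate `k`-conv basis:
for all `j ≤ i` the vector `∑_{l=j}^{i} (b_l)_{1:T}` has `ℓ₁` norm at least `δ`. -/
structure IsNonDegenerateBasis {n k : ℕ} (T : ℕ) (δ : ℝ) (b : Fin k → Fin n → ℝ)
    (m : Fin k → ℕ) : Prop where
  one_le_T : 1 ≤ T
  T_le : T ≤ n
  delta_nonneg : 0 ≤ δ
  one_le_k : 1 ≤ k
  k_le : k ≤ n + 1 - T
  strictAnti : StrictAnti m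
  m_le : ∀ i, m i ≤ n
  T_le_m : ∀ i, T ≤ m i
  le_norm : ∀ i j : Fin k, j ≤ i →
    δ ≤ ∑ t : Fin n, if (t : ℕ) < T then |∑ l ∈ Finset.Icc j i, b l t| else 0

/-- `G = H + R` with `H = ∑ conv(b_i, m_i)` for the `(T, δ)`-non-degenerate `k`-conv basis
`(b, m)`, and `‖R‖_∞ ≤ ε ≤ δ / (5T)`. -/
def IsCloseNonDegenerate {n k : ℕ} (T : ℕ) (δ ε : ℝ) (b : Fin k → Fin n → ℝ) (m : Fin k → ℕ)
    (G : Matrix (Fin n) (Fin n) ℝ) : Prop :=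
  IsNonDegenerateBasis T δ b m ∧
    ∃ R : Matrix (Fin n) (Fin n) ℝ,
      G = (∑ i, subConv (b i) (m i)) + R ∧ ‖R‖ ≤ ε ∧ ε ≤ δ / (5 * T)

/-! ## Step-counted computations

A real RAM with unit-cost `+ - * /`, `|·|`, `exp`, `sin`, `cos` and comparisons on real numbers,
unit-cost arithmetic and comparisons on indices, and arrays with random access. A computation
consists of its result and the number of steps it takes. -/

/-- A result together with the number of steps spent on it. -/
structure Cost (α : Type) where
  val : α
  time : ℕ

instance : Monad Cost where
  pure a := ⟨a, 0⟩
  bind x f := ⟨(f x.val).val, x.time + (f x.val).time⟩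

/-- The result of one primitive operation. -/
def op {α : Type} (a : α) : Cost α := ⟨a, 1⟩

/-- Pay for `c` primitive operations. -/
def charge (c : ℕ) : Cost Unit := ⟨(), c⟩

/-- Read an array at an index, after a check of the index; `0` outside the array. -/
def readAt {α : Type} [Zero α] {N : ℕ} (a : Fin N → α) (i : ℕ) : Cost α :=
  ⟨if h : i < N then a ⟨i, h⟩ else 0, 2⟩

/-- Read a two-dimensional array, after a check of both indices; `0` outside the array. -/
def readAt₂ {N N' : ℕ} (a : Fin N → Fin N' → ℝ) (i j : ℕ) : Cost ℝ :=
  ⟨if h : i < N ∧ j < N' then a ⟨i, h.1⟩ ⟨j, h.2⟩ else 0, 3⟩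

/-- The loop `for i in [0, N): a[i] ← f i` that fills a new array; each round costs the
computation of `f i`, one store, and one step for the loop counter. -/
def tabulate {α : Type} (N : ℕ) (f : Fin N → Cost α) : Cost (Fin N → α) :=
  ⟨fun i => (f i).val, 1 + ∑ i, ((f i).time + 2)⟩

/-- The loop `r ← 0; for i in [0, N): r ← r + f i`; each round costs the computation of `f i`,
one addition, and one step for the loop counter. -/
def sumLoop (N : ℕ) (f : Fin N → Cost ℝ) : Cost ℝ :=
  ⟨∑ i, (f i).val, 1 + ∑ i, ((f i).time + 2)⟩

/-! ## Sub-convolution by the fast Fourier transform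

A complex number is a pair of real numbers, and the step counts of complex operations count
operations on reals. The length `2 ^ p` of an array is stored with it. -/

/-- Complex addition: two real additions. -/
def cadd (x y : ℂ) : Cost ℂ := ⟨x + y, 2⟩

/-- Complex multiplication: four real multiplications, one addition, one subtraction. -/
def cmul (x y : ℂ) : Cost ℂ := ⟨x * y, 6⟩

/-- `exp (σ 2πi j / 2^p)`, evaluated as `cos θ + i sin θ` with `θ = σ * 2 * π * j / 2^p`. -/
def twiddle (σ : ℝ) (p j : ℕ) : Cost ℂ :=
  ⟨⟨Real.cos (σ * 2 * Real.pi * j / 2 ^ p), Real.sin (σ * 2 * Real.pi * j / 2 ^ p)⟩, 6⟩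

/-- The radix-2 fast Fourier transform of an array of length `2 ^ p`: entry `i` of the result is
`∑ j, x j * exp (σ 2πi * i * j / 2^p)`. The sign `σ` is `-1` for the discrete Fourier transform,
and `1` for `2 ^ p` times its inverse. -/
def fft (σ : ℝ) : (p : ℕ) → (Fin (2 ^ p) → ℂ) → Cost (Fin (2 ^ p) → ℂ)
  | 0, x => op x
  | p + 1, x => do
    let even ← tabulate (2 ^ p) fun i => do
      let r ← op (2 * (i : ℕ))
      readAt x r
    let odd ← tabulate (2 ^ p) fun i => do
      let r ← op (2 * (i : ℕ))
      let r' ← op (r + 1)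
      readAt x r'
    let E ← fft σ p even
    let O ← fft σ p odd
    tabulate (2 ^ (p + 1)) fun i => do
      let r ← op ((i : ℕ) % 2 ^ p)
      let e ← readAt E r
      let o ← readAt O r
      let w ← twiddle σ (p + 1) i
      let wo ← cmul w o
      cadd e wo

/-- The least `p` with `N ≤ 2 ^ p`, by repeated halving. -/
def ceilLog₂ (N : ℕ) : Cost ℕ :=
  if N ≤ 1 then op 0
  else do
    -- the comparison, and the two operations in `(N + 1) / 2`
    charge 3
    let p ← ceilLog₂ ((N + 1) / 2)
    op (p + 1)
termination_by N
decreasing_by omega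

/-- `conv(a, m) x` by FFT: `a_{1:m}` and the last `m` entries of `x` are padded with zeros to
length `2 ^ p ≥ 2m`, their circular convolution is computed by three transforms, and its first `m`
entries are the last `m` entries of the result, whose other entries are `0`. -/
def subConvFFT {n : ℕ} (a : Fin n → ℝ) (m : ℕ) (x : Fin n → ℝ) : Cost (Fin n → ℝ) := do
  let len ← op (2 * m)
  let p ← ceilLog₂ len
  -- `2 ^ p` by repeated doubling
  charge (p + 1)
  let off ← op (n - m)
  let a' ← tabulate (2 ^ p) fun l => do
    charge 1
    if (l : ℕ) < m then do
      let y ← readAt a l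
      op (y : ℂ)
    else op 0
  let x' ← tabulate (2 ^ p) fun l => do
    charge 1
    if (l : ℕ) < m then do
      let r ← op (off + (l : ℕ))
      let y ← readAt x r
      op (y : ℂ)
    else op 0
  let A ← fft (-1) p a'
  let X ← fft (-1) p x'
  let P ← tabulate (2 ^ p) fun l => do
    let y ← readAt A l
    let z ← readAt X l
    cmul y z
  let Z ← fft 1 p P
  tabulate n fun i => do
    charge 1
    if off ≤ (i : ℕ) then do
      let r ← op ((i : ℕ) - off)
      let z ← readAt Z r
      op (z.re / 2 ^ p)
    else op 0

/-! ## The algorithm -/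

/-- Column `j` of `H̃ = M ∘ (Q Kᵀ)`, computed as `M_j ∘ (Q (Kᵀ)_j)`. -/
def maskedColumn {n d : ℕ} (Q K : Matrix (Fin n) (Fin d) ℝ) (j : ℕ) : Cost (Fin n → ℝ) :=
  tabulate n fun i => do
    let w ← sumLoop d fun l => do
      let q ← readAt₂ Q i l
      let x ← readAt₂ K j l
      op (q * x)
    let μ ← readAt₂ (causalMask n) i j
    op (μ * w)

/-- Binary search for the position of the next conv basis vector. -/
def search {n d : ℕ} (Q K : Matrix (Fin n) (Fin d) ℝ) (T : ℕ) (δ ε : ℝ) (v : Fin T → ℝ)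
    (s t : ℕ) : Cost ℕ :=
  if t ≤ s then op s
  else do
    -- the comparison, and the two operations in `(s + t) / 2`
    charge 3
    let j := (s + t) / 2
    let col ← maskedColumn Q K j
    let α ← sumLoop T fun l => do
      let r ← op (j + (l : ℕ))
      let x ← readAt col r
      let y ← readAt v l
      let z ← op (x - y)
      op |z|
    let c ← op (2 * (T : ℝ))
    let c' ← op (c * ε)
    let thr ← op (δ - c')
    charge 1
    if thr ≤ α then search Q K T δ ε v s j
    else do
      -- the addition in `j + 1`
      charge 1
      search Q K T δ ε v (j + 1) t
termination_by t - s
decreasing_by all_goals omega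

/-- The loop that recovers the conv basis, with `r` rounds left. The state is the pair of running
sums `v = ∑ (b'_i)_{1:T}` and `u = ∑ b'_i`, and the position `s` at which the next search starts;
`t` is the last possible position. The result lists the pairs `(m_i, b'_i)`. -/
def recoverLoop {n d : ℕ} (Q K : Matrix (Fin n) (Fin d) ℝ) (T : ℕ) (δ ε : ℝ) (t : ℕ) :
    (r : ℕ) → (v : Fin T → ℝ) → (u : Fin n → ℝ) → (s : ℕ) → Cost (List (ℕ × (Fin n → ℝ)))
  | 0, _, _, _ => op []
  | r + 1, v, u, s => do
    let s ← search Q K T δ ε v s t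
    let m ← op (n - s)
    let col ← maskedColumn Q K s
    let b ← tabulate n fun l => do
      charge 1
      if (l : ℕ) < m then do
        let i ← op (s + (l : ℕ))
        let x ← readAt col i
        let y ← readAt u l
        op (x - y)
      else op 0
    let v' ← tabulate T fun l => do
      let x ← readAt v l
      let y ← readAt b l
      op (x + y)
    let u' ← tabulate n fun l => do
      let x ← readAt u l
      let y ← readAt b l
      op (x + y)
    let s' ← op (s + 1)
    let rest ← recoverLoop Q K T δ ε t r v' u' s'
    op ((m, b) :: rest)

/-- `b̃_r = exp (∑_{l ≤ r} b_l) - exp (∑_{l < r} b_l)` for the members of a list,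
where `acc` is the sum of all earlier `b_l`. -/
def expBasisTail {n : ℕ} (acc : Fin n → ℝ) :
    List (ℕ × (Fin n → ℝ)) → Cost (List (ℕ × (Fin n → ℝ)))
  | [] => op []
  | (m, b) :: L => do
    let acc' ← tabulate n fun i => do
      let x ← readAt acc i
      let y ← readAt b i
      op (x + y)
    let c ← tabulate n fun i => do
      let x ← readAt acc' i
      let y ← readAt acc i
      let ex ← op (Real.exp x)
      let ey ← op (Real.exp y)
      op (ex - ey)
    let rest ← expBasisTail acc' L
    op ((m, c) :: rest)

/-- `b̃_1 = exp b_1` and `b̃_r = exp (∑_{l ≤ r} b_l) - exp (∑_{l < r} b_l)` for `r ≥ 2`. -/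
def expBasis {n : ℕ} : List (ℕ × (Fin n → ℝ)) → Cost (List (ℕ × (Fin n → ℝ)))
  | [] => op []
  | (m, b) :: L => do
    let c ← tabulate n fun i => do
      let x ← readAt b i
      op (Real.exp x)
    let rest ← expBasisTail b L
    op ((m, c) :: rest)

/-- Recover the pairs `(m_1, b̃_1), …, (m_k, b̃_k)`. -/
def recover {n d : ℕ} (Q K : Matrix (Fin n) (Fin d) ℝ) (k T : ℕ) (δ ε : ℝ) :
    Cost (List (ℕ × (Fin n → ℝ))) := do
  let v ← tabulate T fun _ => op 0
  let u ← tabulate n fun _ => op 0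
  let t ← op (n - T)
  let L ← recoverLoop Q K T δ ε t k v u 0
  expBasis L

/-- `∑_r conv(b̃_r, m_r) x` by FFT, for a list of pairs `(m_r, b̃_r)`. -/
def applyBasis {n : ℕ} : List (ℕ × (Fin n → ℝ)) → (Fin n → ℝ) → Cost (Fin n → ℝ)
  | [], _ => tabulate n fun _ => op 0
  | (m, b) :: L, x => do
    let y ← subConvFFT b m x
    let z ← applyBasis L x
    tabulate n fun i => do
      let yi ← readAt y i
      let zi ← readAt z i
      op (yi + zi)

/-- The diagonal `∑_r conv(b̃_r, m_r) 1` of `D̃`, by FFT. -/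
def approxNormalizer {n : ℕ} (L : List (ℕ × (Fin n → ℝ))) : Cost (Fin n → ℝ) := do
  let ones ← tabulate n fun _ => op 1
  applyBasis L ones

/-- The algorithm: recover the conv basis, and return `Ỹ = D̃⁻¹ ∑_r conv(b̃_r, m_r) V`. -/
def convForward {n d : ℕ} (Q K V : Matrix (Fin n) (Fin d) ℝ) (k T : ℕ) (δ ε : ℝ) :
    Cost (Matrix (Fin n) (Fin d) ℝ) := do
  let L ← recover Q K k T δ ε
  let D ← approxNormalizer L
  let cols ← tabulate d fun c => do
    let x ← tabulate n fun i => readAt₂ V i c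
    applyBasis L x
  tabulate n fun i => tabulate d fun c => do
    let y ← readAt₂ cols c i
    let z ← readAt D i
    op (y / z)

end ConvAttention

end

noncomputable section
namespace ConvAttention

/-! ## Values and times of the basic computations -/

namespace Cost

/-! Put `pos q = n - m q`. Read from its diagonal entry downwards, column `j` of `H̃` is within `ε`
of the sum of all basis vectors with `pos q ≤ j`. The columns between two consecutive positions are
therefore the same vector up to `2 * ε`, and only the positions have to be found (`IsSeparated`,
`IsCloseNonDegenerate.isSeparated`).

The errors of the rounds do not accumulate. A round adds to `u` the column at the position found
minus `u`, so on the relevant entries `u` becomes that column itself, and its truncation `v` is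
again within `ε` of the true partial sum. Hence the tested norm is at most `2Tε` before the next
position and at least `δ - 2Tε` from there on. As `4Tε < δ`, the test is a monotone predicate and
the binary search returns the exact position (`IsSeparated.test_iff`, `search_val`). If `δ = 0`, the
assumption on `k` leaves no freedom for the positions, and no search ever examines a column before
its target.

The differences of exponentials telescope, so column `c` of the approximate matrix is the
exponential of the shifted column of `H̃` at the last position up to `c` (`basisMatrix_recover`).
The exponents are off by at most `2ε`, which gives an entrywise relative error `η = exp (2ε) - 1`.
Each row of the output is a weighted average of rows of `V`, and changing positive weights by a
relative error `η` moves it by at most `2η‖V‖` (`abs_weighted_average_sub_le`).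

For the running time, each of the `k` searches looks at `O(log n)` columns of cost `O(nd)`, and the
`k(d + 1)` sub-convolution products cost `O(n log n)` each by FFT, whose correctness is the
convolution theorem `fft_mul_fft`. -/

@[simp] theorem val_bind {α β : Type} (x : Cost α) (f : α → Cost β) :
    (x >>= f).val = (f x.val).val := rfl

@[simp] theorem time_bind {α β : Type} (x : Cost α) (f : α → Cost β) :
    (x >>= f).time = x.time + (f x.val).time := rfl

@[simp] theorem val_ite {α : Type} (c : Prop) [Decidable c] (x y : Cost α) :
    (if c then x else y).val = if c then x.val else y.val := apply_ite _ _ _ _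

@[simp] theorem time_ite {α : Type} (c : Prop) [Decidable c] (x y : Cost α) :
    (if c then x else y).time = if c then x.time else y.time := apply_ite _ _ _ _

end Cost

@[simp] theorem op_val {α : Type} (a : α) : (op a).val = a := rfl
@[simp] theorem op_time {α : Type} (a : α) : (op a).time = 1 := rfl
@[simp] theorem charge_time (c : ℕ) : (charge c).time = c := rfl
@[simp] theorem readAt_time {α : Type} [Zero α] {N : ℕ} (a : Fin N → α) (i : ℕ) :
    (readAt a i).time = 2 := rfl
@[simp] theorem readAt₂_time {N N' : ℕ} (a : Fin N → Fin N' → ℝ) (i j : ℕ) :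
    (readAt₂ a i j).time = 3 := rfl
@[simp] theorem readAt₂_matrix_time {N N' : ℕ} (a : Matrix (Fin N) (Fin N') ℝ) (i j : ℕ) :
    (readAt₂ a i j).time = 3 := rfl
@[simp] theorem tabulate_val {α : Type} (N : ℕ) (f : Fin N → Cost α) (i : Fin N) :
    (tabulate N f).val i = (f i).val := rfl
@[simp] theorem tabulate_time {α : Type} (N : ℕ) (f : Fin N → Cost α) :
    (tabulate N f).time = 1 + ∑ i, ((f i).time + 2) := rfl
@[simp] theorem sumLoop_val (N : ℕ) (f : Fin N → Cost ℝ) :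
    (sumLoop N f).val = ∑ i, (f i).val := rfl
@[simp] theorem sumLoop_time (N : ℕ) (f : Fin N → Cost ℝ) :
    (sumLoop N f).time = 1 + ∑ i, ((f i).time + 2) := rfl
@[simp] theorem cadd_val (x y : ℂ) : (cadd x y).val = x + y := rfl
@[simp] theorem cadd_time (x y : ℂ) : (cadd x y).time = 2 := rfl
@[simp] theorem cmul_val (x y : ℂ) : (cmul x y).val = x * y := rfl
@[simp] theorem cmul_time (x y : ℂ) : (cmul x y).time = 6 := rfl
@[simp] theorem twiddle_time (σ : ℝ) (p j : ℕ) : (twiddle σ p j).time = 6 := rfl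

theorem readAt_val_of_lt {α : Type} [Zero α] {N : ℕ} (a : Fin N → α) {i : ℕ} (h : i < N) :
    (readAt a i).val = a ⟨i, h⟩ := by
  simp [readAt, h]

@[simp] theorem readAt_val_fin {α : Type} [Zero α] {N : ℕ} (a : Fin N → α) (i : Fin N) :
    (readAt a i).val = a i :=
  readAt_val_of_lt a i.isLt

theorem readAt₂_val_of_lt {N N' : ℕ} (a : Fin N → Fin N' → ℝ) {i j : ℕ} (hi : i < N)
    (hj : j < N') : (readAt₂ a i j).val = a ⟨i, hi⟩ ⟨j, hj⟩ := by
  simp [readAt₂, hi, hj]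

@[simp] theorem readAt₂_val_fin {N N' : ℕ} (a : Fin N → Fin N' → ℝ) (i : Fin N) (j : Fin N') :
    (readAt₂ a i j).val = a i j :=
  readAt₂_val_of_lt a i.isLt j.isLt

/-! ## The fast Fourier transform -/

/-- The root of unity `exp (σ 2πi / 2^p)` for an integer `σ`. -/
def fftRoot (σ : ℤ) (p : ℕ) : ℂ := Complex.exp (σ * (2 * Real.pi * Complex.I / 2 ^ p))

theorem fftRoot_succ_sq (σ : ℤ) (p : ℕ) : fftRoot σ (p + 1) ^ 2 = fftRoot σ p := by
  rw [fftRoot, fftRoot, ← Complex.exp_nat_mul]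
  congr 1
  push_cast
  field_simp
  ring

theorem fftRoot_pow_two_pow (σ : ℤ) (p : ℕ) : fftRoot σ p ^ 2 ^ p = 1 := by
  rw [fftRoot, ← Complex.exp_nat_mul, Complex.exp_eq_one_iff]
  refine ⟨σ, ?_⟩
  push_cast
  field_simp

theorem fftRoot_pow_mod (σ : ℤ) (p i : ℕ) : fftRoot σ p ^ (i % 2 ^ p) = fftRoot σ p ^ i :=
  (pow_eq_pow_mod i (fftRoot_pow_two_pow σ p)).symm

theorem twiddle_val (σ : ℤ) (p j : ℕ) : (twiddle (σ : ℝ) p j).val = fftRoot σ p ^ j := by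
  have h : fftRoot σ p ^ j
      = Complex.exp (((σ * 2 * Real.pi * j / 2 ^ p : ℝ) : ℂ) * Complex.I) := by
    rw [fftRoot, ← Complex.exp_nat_mul]
    congr 1
    push_cast
    ring
  rw [h, Complex.exp_mul_I, ← Complex.ofReal_cos, ← Complex.ofReal_sin, ← Complex.mk_eq_add_mul_I]
  rfl

theorem sum_range_two_mul {M : Type*} [AddCommMonoid M] (f : ℕ → M) (N : ℕ) :
    ∑ j ∈ Finset.range (2 * N), f j
      = ∑ j ∈ Finset.range N, f (2 * j) + ∑ j ∈ Finset.range N, f (2 * j + 1) := by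
  rw [← Finset.sum_add_distrib]
  induction N with
  | zero => simp
  | succ N ih =>
    rw [show 2 * (N + 1) = 2 * N + 1 + 1 by ring, Finset.sum_range_succ, Finset.sum_range_succ,
      Finset.sum_range_succ, ih, add_assoc]

/-- Radix-2 splitting: squaring the root of level `p + 1` gives the root of level `p`, so the terms
of even and of odd index form two half-length transforms. These may be read at `i % 2 ^ p` because
the root has order dividing `2 ^ p`, which is where the integrality of `σ` enters. -/
theorem fft_val (σ : ℤ) : ∀ (p : ℕ) (x : Fin (2 ^ p) → ℂ) (i : Fin (2 ^ p)),
    (fft (σ : ℝ) p x).val i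
      = ∑ j ∈ Finset.range (2 ^ p), (readAt x j).val * fftRoot σ p ^ ((i : ℕ) * j)
  | 0, x, i => by
    have : i = (0 : Fin 1) := Subsingleton.elim (α := Fin 1) _ _
    subst this
    simp [fft, readAt]
  | p + 1, x, i => by
    have hr : (i : ℕ) % 2 ^ p < 2 ^ p := Nat.mod_lt _ (by positivity)
    have hs := sum_range_two_mul
      (fun j => (readAt x j).val * fftRoot σ (p + 1) ^ ((i : ℕ) * j)) (2 ^ p)
    rw [← pow_succ'] at hs
    rw [hs]
    simp only [fft, Cost.val_bind, tabulate_val, op_val, cadd_val, cmul_val, twiddle_val,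
      readAt_val_of_lt _ hr, fft_val σ p, Finset.mul_sum]
    congr 1
    · refine Finset.sum_congr rfl fun j hj => ?_
      rw [readAt_val_of_lt _ (Finset.mem_range.1 hj), tabulate_val, pow_mul, fftRoot_pow_mod,
        ← fftRoot_succ_sq σ p, ← pow_mul, ← pow_mul]
      simp only [Cost.val_bind, op_val]
      congr 2
      ring
    · refine Finset.sum_congr rfl fun j hj => ?_
      rw [readAt_val_of_lt _ (Finset.mem_range.1 hj), tabulate_val, pow_mul, fftRoot_pow_mod,
        ← fftRoot_succ_sq σ p, ← pow_mul, ← pow_mul, mul_left_comm, ← pow_add]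
      simp only [Cost.val_bind, op_val]
      congr 2
      ring

theorem isPrimitiveRoot_fftRoot (p : ℕ) : IsPrimitiveRoot (fftRoot 1 p) (2 ^ p) := by
  have h := Complex.isPrimitiveRoot_exp (2 ^ p) (by positivity)
  simpa [fftRoot] using h

theorem fftRoot_neg_one_mul (p : ℕ) : fftRoot (-1) p * fftRoot 1 p = 1 := by
  rw [fftRoot, fftRoot, ← Complex.exp_add]
  simp

/-- Orthogonality of the characters of `ℤ / 2^p`. -/
theorem sum_fftRoot (p a c : ℕ) (h : (a : ℤ) - c < 2 ^ p ∧ (c : ℤ) - a < 2 ^ p) :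
    ∑ l ∈ Finset.range (2 ^ p), fftRoot (-1) p ^ (l * a) * fftRoot 1 p ^ (l * c)
      = if a = c then 2 ^ p else 0 := by
  have hinv : fftRoot (-1) p = (fftRoot 1 p)⁻¹ :=
    eq_inv_of_mul_eq_one_left (fftRoot_neg_one_mul p)
  have h0 : fftRoot 1 p ≠ 0 := Complex.exp_ne_zero _
  set z : ℂ := fftRoot (-1) p ^ a * fftRoot 1 p ^ c with hz
  have hsum : ∑ l ∈ Finset.range (2 ^ p), fftRoot (-1) p ^ (l * a) * fftRoot 1 p ^ (l * c)
      = ∑ l ∈ Finset.range (2 ^ p), z ^ l :=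
    Finset.sum_congr rfl fun l _ => by
      rw [hz, mul_pow, ← pow_mul, ← pow_mul, mul_comm a, mul_comm c]
  rw [hsum]
  split_ifs with hac
  · subst hac
    have : z = 1 := by rw [hz, ← mul_pow, fftRoot_neg_one_mul, one_pow]
    simp [this]
  -- The ratio is a primitive root to the power `c - a`, and a nonzero integer of absolute value
  -- below `2 ^ p` is no multiple of `2 ^ p`.
  · have hz1 : z ≠ 1 := by
      have hz' : z = fftRoot 1 p ^ ((c : ℤ) - a) := by
        rw [hz, hinv, zpow_sub₀ h0, zpow_natCast, zpow_natCast, inv_pow]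
        field_simp
      rw [hz', Ne, (isPrimitiveRoot_fftRoot p).zpow_eq_one_iff_dvd]
      intro hd
      obtain ⟨q, hq⟩ := hd
      push_cast at hq
      have hN : (0 : ℤ) < 2 ^ p := by positivity
      rcases lt_trichotomy q 0 with hq0 | hq0 | hq0
      · nlinarith
      · subst hq0
        omega
      · nlinarith
    have hzN : z ^ 2 ^ p = 1 := by
      rw [hz, mul_pow, ← pow_mul, ← pow_mul, mul_comm a, mul_comm c, pow_mul, pow_mul,
        fftRoot_pow_two_pow, fftRoot_pow_two_pow, one_pow, one_pow, one_mul]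
    rw [geom_sum_eq hz1, hzN, sub_self, zero_div]

theorem ceilLog₂_le_two_pow (N : ℕ) : N ≤ 2 ^ (ceilLog₂ N).val := by
  induction N using Nat.strong_induction_on with
  | _ N ih =>
    rw [ceilLog₂]
    split_ifs with h
    · simpa using h
    · have := ih ((N + 1) / 2) (by omega)
      simp only [Cost.val_bind, op_val, pow_succ]
      omega

theorem ceilLog₂_two_pow_lt (N : ℕ) (hN : 1 ≤ N) : 2 ^ (ceilLog₂ N).val < 2 * N := by
  induction N using Nat.strong_induction_on with
  | _ N ih =>
    rw [ceilLog₂]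
    split_ifs with h
    · simp
      omega
    · have := ih ((N + 1) / 2) (by omega) (by omega)
      simp only [Cost.val_bind, op_val, pow_succ]
      -- For odd `N` the induction hypothesis only yields `2 ^ v ≤ N`. Strictness then comes from
      -- parity, which needs `v ≠ 0`.
      rcases hv : (ceilLog₂ ((N + 1) / 2)).val with _ | e
      · simp
        omega
      · rw [hv, pow_succ] at this
        rw [pow_succ]
        omega

theorem ceilLog₂_time (N : ℕ) : (ceilLog₂ N).time = 4 * (ceilLog₂ N).val + 1 := by
  induction N using Nat.strong_induction_on with
  | _ N ih =>
    rw [ceilLog₂]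
    split_ifs with h
    · simp
    · have := ih ((N + 1) / 2) (by omega)
      simp only [Cost.val_bind, Cost.time_bind, op_val, op_time, charge_time]
      omega

theorem fft_one_val (p : ℕ) (x : Fin (2 ^ p) → ℂ) (i : Fin (2 ^ p)) :
    (fft 1 p x).val i
      = ∑ j ∈ Finset.range (2 ^ p), (readAt x j).val * fftRoot 1 p ^ ((i : ℕ) * j) := by
  simpa using fft_val 1 p x i

theorem fft_neg_one_val (p : ℕ) (x : Fin (2 ^ p) → ℂ) (i : Fin (2 ^ p)) :
    (fft (-1) p x).val i
      = ∑ j ∈ Finset.range (2 ^ p), (readAt x j).val * fftRoot (-1) p ^ ((i : ℕ) * j) := by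
  simpa using fft_val (-1) p x i

/-- The convolution theorem, for arrays whose support is short enough to avoid wrap-around. -/
theorem fft_mul_fft {p m : ℕ} (hm : 2 * m ≤ 2 ^ p) (a x : Fin (2 ^ p) → ℂ) (α β : ℕ → ℂ)
    (hα : ∀ j : Fin (2 ^ p), a j = α j) (hβ : ∀ j : Fin (2 ^ p), x j = β j)
    (hα0 : ∀ j, m ≤ j → α j = 0) (hβ0 : ∀ j, m ≤ j → β j = 0)
    (c : Fin (2 ^ p)) (hc : (c : ℕ) < m) :
    (fft 1 p fun l => (fft (-1) p a).val l * (fft (-1) p x).val l).val c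
      = 2 ^ p * ∑ j ∈ Finset.range (c + 1), α (c - j) * β j := by
  have hA : ∀ (y : Fin (2 ^ p) → ℂ) (η : ℕ → ℂ), (∀ j : Fin (2 ^ p), y j = η j) →
      (∀ j, m ≤ j → η j = 0) → ∀ l : Fin (2 ^ p), (fft (-1) p y).val l
        = ∑ j ∈ Finset.range m, η j * fftRoot (-1) p ^ ((l : ℕ) * j) := by
    intro y η hy h0 l
    rw [fft_neg_one_val]
    symm
    refine Finset.sum_subset_zero_on_sdiff (Finset.range_mono (by omega)) ?_ ?_
    · intro j hj
      simp only [Finset.mem_sdiff, Finset.mem_range, not_lt] at hj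
      rw [readAt_val_of_lt _ hj.1, hy, h0 _ hj.2, zero_mul]
    · intro j hj
      have hj' : j < 2 ^ p := by
        have := Finset.mem_range.1 hj
        omega
      rw [readAt_val_of_lt _ hj', hy]
  rw [fft_one_val]
  have h1 : ∀ l ∈ Finset.range (2 ^ p),
      (readAt (fun l => (fft (-1) p a).val l * (fft (-1) p x).val l) l).val
          * fftRoot 1 p ^ ((c : ℕ) * l)
        = ∑ i ∈ Finset.range m, ∑ j ∈ Finset.range m, α i * β j
            * (fftRoot (-1) p ^ (l * (i + j)) * fftRoot 1 p ^ (l * (c : ℕ))) := by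
    intro l hl
    rw [readAt_val_of_lt _ (Finset.mem_range.1 hl), hA a α hα hα0, hA x β hβ hβ0,
      Finset.sum_mul_sum, Finset.sum_mul]
    refine Finset.sum_congr rfl fun i _ => ?_
    rw [Finset.sum_mul]
    refine Finset.sum_congr rfl fun j _ => ?_
    rw [mul_add l i j, pow_add, mul_comm (c : ℕ) l]
    ring
  rw [Finset.sum_congr rfl h1, Finset.sum_comm]
  have h2 : ∀ i ∈ Finset.range m, ∑ l ∈ Finset.range (2 ^ p), ∑ j ∈ Finset.range m, α i * β j
            * (fftRoot (-1) p ^ (l * (i + j)) * fftRoot 1 p ^ (l * (c : ℕ)))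
      = ∑ j ∈ Finset.range m, if i + j = c then α i * β j * 2 ^ p else 0 := by
    intro i hi
    rw [Finset.sum_comm]
    refine Finset.sum_congr rfl fun j hj => ?_
    -- Both `i + j ≤ 2m - 2` and `c` are below `2 ^ p`, so there is no wrap-around and only `i + j =
    -- c` survives.
    rw [← Finset.mul_sum, sum_fftRoot, mul_ite, mul_zero]
    have hi' := Finset.mem_range.1 hi
    have hj' := Finset.mem_range.1 hj
    zify at hi' hj' hm hc
    constructor <;> push_cast <;> linarith
  rw [Finset.sum_congr rfl h2, Finset.sum_comm, Finset.mul_sum]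
  symm
  refine Finset.sum_subset_zero_on_sdiff (Finset.range_mono (by omega)) ?_ ?_
  · intro j hj
    simp only [Finset.mem_sdiff, Finset.mem_range, not_lt] at hj
    refine Finset.sum_eq_zero fun i _ => ?_
    rw [if_neg (by omega)]
  · intro j hj
    have hj' := Finset.mem_range.1 hj
    rw [Finset.sum_eq_single ((c : ℕ) - j), if_pos (by omega)]
    · ring
    · intro i _ hij
      rw [if_neg (by omega)]
    · intro h
      simp only [Finset.mem_range] at h
      omega

/-! ### Products with sub-convolution matrices. -/

theorem subConv_of_mem {n : ℕ} (a : Fin n → ℝ) {m : ℕ} {i j : Fin n}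
    (h : n - m ≤ (j : ℕ) ∧ (j : ℕ) ≤ i) : subConv a m i j = (readAt a ((i : ℕ) - j)).val := by
  have hij : (i : ℕ) - j < n := by omega
  rw [readAt_val_of_lt _ hij]
  exact if_pos h

theorem subConv_of_notMem {n : ℕ} (a : Fin n → ℝ) {m : ℕ} {i j : Fin n}
    (h : ¬ (n - m ≤ (j : ℕ) ∧ (j : ℕ) ≤ i)) : subConv a m i j = 0 :=
  if_neg h

theorem subConvFFT_val {n : ℕ} (a : Fin n → ℝ) {m : ℕ} (hm : m ≤ n) (x : Fin n → ℝ) :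
    (subConvFFT a m x).val = (subConv a m).mulVec x := by
  funext i
  have hp := ceilLog₂_le_two_pow (2 * m)
  simp only [subConvFFT, Cost.val_bind, tabulate_val, Cost.val_ite]
  simp only [op_val]
  set p := (ceilLog₂ (2 * m)).val with hpdef
  set α : ℕ → ℝ := fun l => if l < m then (readAt a l).val else 0 with hα
  set β : ℕ → ℝ := fun l => if l < m then (readAt x (n - m + l)).val else 0 with hβ
  split_ifs with hi
  · have hi' := i.isLt
    have hc : (i : ℕ) - (n - m) < m := by omega
    have hc2 : (i : ℕ) - (n - m) < 2 ^ p := by omega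
    rw [readAt_val_of_lt _ hc2]
    have key := fft_mul_fft hp
      (fun l : Fin (2 ^ p) => if (l : ℕ) < m then ((readAt a l).val : ℂ) else 0)
      (fun l : Fin (2 ^ p) => if (l : ℕ) < m then ((readAt x (n - m + l)).val : ℂ) else 0)
      (fun l => (α l : ℂ)) (fun l => (β l : ℂ))
      (fun j => by simp only [hα]; split_ifs <;> simp)
      (fun j => by simp only [hβ]; split_ifs <;> simp)
      (fun j hj => by simp [hα, hj]) (fun j hj => by simp [hβ, hj]) ⟨_, hc2⟩ hc
    have e1 : (tabulate (2 ^ p) fun l : Fin (2 ^ p) => do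
          charge 1
          if (l : ℕ) < m then do
            let y ← readAt a l
            op (y : ℂ)
          else op 0).val
        = fun l : Fin (2 ^ p) => if (l : ℕ) < m then ((readAt a l).val : ℂ) else 0 := by
      funext l
      simp
    have e2 : (tabulate (2 ^ p) fun l : Fin (2 ^ p) => do
          charge 1
          if (l : ℕ) < m then do
            let r ← op (n - m + (l : ℕ))
            let y ← readAt x r
            op (y : ℂ)
          else op 0).val
        = fun l : Fin (2 ^ p) => if (l : ℕ) < m then ((readAt x (n - m + l)).val : ℂ) else 0 := by
      funext l
      simp
    have e3 : ∀ A X : Fin (2 ^ p) → ℂ, (tabulate (2 ^ p) fun l : Fin (2 ^ p) => do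
          let y ← readAt A l
          let z ← readAt X l
          cmul y z).val = fun l => A l * X l := by
      intro A X
      funext l
      simp
    rw [e1, e2, e3, key]
    have hre : ((2 : ℂ) ^ p * ∑ j ∈ Finset.range ((i : ℕ) - (n - m) + 1),
          (α ((i : ℕ) - (n - m) - j) : ℂ) * (β j : ℂ))
        = ((2 ^ p * ∑ j ∈ Finset.range ((i : ℕ) - (n - m) + 1),
          α ((i : ℕ) - (n - m) - j) * β j : ℝ) : ℂ) := by
      push_cast
      rfl
    rw [hre, Complex.ofReal_re, mul_div_cancel_left₀ _ (by positivity)]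
    simp only [Matrix.mulVec, dotProduct]
    symm
    let f : ℕ → ℝ := fun j =>
      if n - m ≤ j ∧ j ≤ i then (readAt a (i - j)).val * (readAt x j).val else 0
    have hf : ∀ j : Fin n, subConv a m i j * x j = f j := by
      intro j
      by_cases h : n - m ≤ (j : ℕ) ∧ (j : ℕ) ≤ i
      · simp only [f]
        rw [if_pos h, subConv_of_mem a h, readAt_val_fin]
      · simp only [f]
        rw [if_neg h, subConv_of_notMem a h, zero_mul]
    -- The columns before `n - m` contribute nothing. Shifting the others by `n - m` turns the row
    -- sum into a linear convolution, cut off at the diagonal.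
    rw [Finset.sum_congr rfl fun j _ => hf j, Fin.sum_univ_eq_sum_range f n,
      ← Finset.sum_range_add_sum_Ico f (Nat.sub_le n m), Finset.sum_eq_zero, zero_add,
      Finset.sum_Ico_eq_sum_range]
    · symm
      refine Finset.sum_subset_zero_on_sdiff (Finset.range_mono (by omega)) ?_ ?_
      · intro j hj
        simp only [Finset.mem_sdiff, Finset.mem_range, not_lt] at hj
        simp only [f]
        rw [if_neg (by omega)]
      · intro j hj
        have hj' := Finset.mem_range.1 hj
        simp only [f, hα, hβ]
        rw [if_pos (by omega), if_pos (by omega), if_pos (by omega)]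
        congr 3
        omega
    · intro j hj
      have hj' := Finset.mem_range.1 hj
      simp only [f]
      rw [if_neg (by omega)]
  · simp only [Matrix.mulVec, dotProduct]
    symm
    refine Finset.sum_eq_zero fun j _ => ?_
    rw [subConv_of_notMem a (by omega), zero_mul]

/-- The matrix `∑_r conv(b_r, m_r)` of a list of pairs `(m_r, b_r)`. -/
def basisMatrix {n : ℕ} : List (ℕ × (Fin n → ℝ)) → Matrix (Fin n) (Fin n) ℝ
  | [] => 0
  | (m, b) :: L => subConv b m + basisMatrix L

theorem applyBasis_val {n : ℕ} (x : Fin n → ℝ) :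
    ∀ L : List (ℕ × (Fin n → ℝ)), (∀ p ∈ L, p.1 ≤ n) →
      (applyBasis L x).val = (basisMatrix L).mulVec x
  | [], _ => by
    funext i
    simp [applyBasis, basisMatrix]
  | (m, b) :: L, h => by
    funext i
    have h1 := applyBasis_val x L fun p hp => h p (List.mem_cons_of_mem _ hp)
    have h2 := subConvFFT_val b (h (m, b) List.mem_cons_self) x
    simp [applyBasis, basisMatrix, h1, h2, Matrix.add_mulVec]

theorem approxNormalizer_val {n : ℕ} (L : List (ℕ × (Fin n → ℝ))) (h : ∀ p ∈ L, p.1 ≤ n) :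
    (approxNormalizer L).val = (basisMatrix L).mulVec 1 := by
  have : (tabulate n fun _ => op (1 : ℝ)).val = 1 := by
    funext i
    simp
  simp [approxNormalizer, this, applyBasis_val _ L h]

theorem convForward_val {n d : ℕ} (Q K V : Matrix (Fin n) (Fin d) ℝ) (k T : ℕ) (δ ε : ℝ)
    (h : ∀ p ∈ (recover Q K k T δ ε).val, p.1 ≤ n) (i : Fin n) (c : Fin d) :
    (convForward Q K V k T δ ε).val i c
      = (∑ j, basisMatrix (recover Q K k T δ ε).val i j * V j c)
        / ∑ j, basisMatrix (recover Q K k T δ ε).val i j := by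
  have hc : (tabulate n fun j => readAt₂ V j c).val = fun j => V j c := by
    funext j
    exact readAt₂_val_fin V j c
  simp [convForward, tabulate_val, approxNormalizer_val _ h, applyBasis_val _ _ h, hc,
    Matrix.mulVec, dotProduct]


/-! ## Step counts -/

/-- The summand `3` absorbs the start-up steps of the three loops of a level: with `F p` the time,
`F (p + 1) + 3 = 2 * (F p + 3) + 53 * 2 ^ p`, and `53 ≤ 2 * 27` closes the induction. -/
theorem fft_time (σ : ℝ) : ∀ (p : ℕ) (x : Fin (2 ^ p) → ℂ),
    (fft σ p x).time + 3 ≤ 2 ^ p * (27 * p + 4)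
  | 0, x => by simp [fft]
  | p + 1, x => by
    simp only [fft, Cost.time_bind, tabulate_time, op_time, readAt_time,
      twiddle_time, cmul_time, cadd_time, Finset.sum_const, Finset.card_univ, Fintype.card_fin,
      smul_eq_mul]
    have h1 := fft_time σ p
    refine le_trans (Nat.add_le_add_right (Nat.add_le_add_left (Nat.add_le_add_left
      (Nat.add_le_add (Nat.le_sub_of_add_le (h1 _)) (Nat.add_le_add_right
      (Nat.le_sub_of_add_le (h1 _)) _)) _) _) _) ?_
    have h2 : 3 ≤ 2 ^ p * (27 * p + 4) :=
      le_trans (by omega) (Nat.mul_le_mul (Nat.one_le_two_pow (n := p)) (Nat.le_add_left 4 _))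
    rw [pow_succ]
    zify [h2]
    nlinarith

theorem sum_le_mul_of_le {N c : ℕ} (g : Fin N → ℕ) (hg : ∀ i, g i ≤ c) : ∑ i, g i ≤ N * c := by
  simpa using Finset.sum_le_card_nsmul Finset.univ g c fun i _ => hg i

theorem ite_le_add (c : Prop) [Decidable c] (a b : ℕ) : (if c then a else b) ≤ a + b := by
  split <;> omega

theorem subConvFFT_time {n : ℕ} (a : Fin n → ℝ) {m : ℕ} (hm : m ≤ n) (x : Fin n → ℝ) {e : ℕ}
    (he : n < 2 ^ e) (h1 : 1 ≤ e) (hn : 1 ≤ n) :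
    (subConvFFT a m x).time ≤ 1500 * (n * e) := by
  -- The padded length is less than twice `2 * m`. The case `m = 0`, where it is `1`, is separate
  -- because `ceilLog₂_two_pow_lt` needs a positive argument.
  have hP : 2 ^ (ceilLog₂ (2 * m)).val ≤ 4 * n := by
    rcases Nat.eq_zero_or_pos m with rfl | hm0
    · simp [ceilLog₂]
      omega
    · have := ceilLog₂_two_pow_lt (2 * m) (by omega)
      omega
  have hp : (ceilLog₂ (2 * m)).val ≤ e + 1 := by
    have h : 2 ^ (ceilLog₂ (2 * m)).val < 2 ^ (e + 2) := by
      rw [pow_add]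
      omega
    have := (Nat.pow_lt_pow_iff_right (by norm_num)).1 h
    omega
  have hF : ∀ (σ : ℝ) (x : Fin (2 ^ (ceilLog₂ (2 * m)).val) → ℂ),
      (fft σ (ceilLog₂ (2 * m)).val x).time ≤ 4 * n * (27 * (e + 1) + 4) :=
    fun σ x => calc
      (fft σ (ceilLog₂ (2 * m)).val x).time
          ≤ 2 ^ (ceilLog₂ (2 * m)).val * (27 * (ceilLog₂ (2 * m)).val + 4) := by
        have := fft_time σ (ceilLog₂ (2 * m)).val x
        omega
      _ ≤ 4 * n * (27 * (e + 1) + 4) := by gcongr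
  simp only [subConvFFT, Cost.time_bind, tabulate_time, Cost.time_ite]
  simp only [op_val, ceilLog₂_time, op_time, charge_time, readAt_time, cmul_time]
  calc
    _ ≤ 1 + (4 * (e + 1) + 1 + ((e + 1) + 1 + (1 + (1 + 4 * n * 12 + (1 + 4 * n * 12
        + (4 * n * (27 * (e + 1) + 4) + (4 * n * (27 * (e + 1) + 4) + (1 + 4 * n * 12
        + (4 * n * (27 * (e + 1) + 4) + (1 + n * 12)))))))))) := by
      gcongr
      · exact (sum_le_mul_of_le (c := 12) _ fun i => by split_ifs <;> omega).trans (by gcongr)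
      · exact (sum_le_mul_of_le (c := 12) _ fun i => by split_ifs <;> omega).trans (by gcongr)
      · exact hF _ _
      · exact hF _ _
      · exact (sum_le_mul_of_le (c := 12) _ fun i => by omega).trans (by gcongr)
      · exact hF _ _
      · exact sum_le_mul_of_le _ fun i => by split_ifs <;> omega
    _ ≤ 1500 * (n * e) := by nlinarith

theorem applyBasis_time {n : ℕ} (x : Fin n → ℝ) {e : ℕ} (he : n < 2 ^ e) (h1 : 1 ≤ e)
    (hn : 1 ≤ n) : ∀ L : List (ℕ × (Fin n → ℝ)), (∀ p ∈ L, p.1 ≤ n) →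
      (applyBasis L x).time ≤ (1510 * L.length + 10) * (n * e)
  | [], _ => by
    simp [applyBasis]
    nlinarith
  | (m, b) :: L, h => by
    have h2 := applyBasis_time x he h1 hn L fun p hp => h p (List.mem_cons_of_mem _ hp)
    have h3 := subConvFFT_time b (h (m, b) List.mem_cons_self) x he h1 hn
    simp [applyBasis]
    nlinarith

theorem maskedColumn_time {n d : ℕ} (Q K : Matrix (Fin n) (Fin d) ℝ) (j : ℕ) :
    (maskedColumn Q K j).time = 1 + n * (9 * d + 7) := by
  simp only [maskedColumn, tabulate_time, sumLoop_time, Cost.time_bind, op_time,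
    readAt₂_matrix_time, Finset.sum_const, Finset.card_univ, Fintype.card_fin, smul_eq_mul]
  ring

/-- Each test halves the window, so `e` bounds the number of tests; the factor of `e` is the price
of one column and one `ℓ₁` norm. -/
theorem search_time {n d : ℕ} (Q K : Matrix (Fin n) (Fin d) ℝ) (T : ℕ) (δ ε : ℝ)
    (v : Fin T → ℝ) : ∀ (e s t : ℕ), t - s < 2 ^ e →
      (search Q K T δ ε v s t).time ≤ 1 + e * (n * (9 * d + 7) + 9 * T + 20)
  | e, s, t, h => by
    rw [search]
    split_ifs with hst
    · simp
    obtain _ | e := e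
    · simp at h
      omega
    have hl := search_time Q K T δ ε v e s ((s + t) / 2) (by rw [pow_succ] at h; omega)
    have hr := search_time Q K T δ ε v e ((s + t) / 2 + 1) t (by rw [pow_succ] at h; omega)
    simp [maskedColumn_time]
    split_ifs <;> nlinarith

theorem recoverLoop_time {n d : ℕ} (Q K : Matrix (Fin n) (Fin d) ℝ) {T : ℕ} (δ ε : ℝ) {t : ℕ}
    {e : ℕ} (ht : t < 2 ^ e) (hT : T ≤ n) (h1 : 1 ≤ e) (hn : 1 ≤ n) (hd : 1 ≤ d) :
    ∀ (r : ℕ) (v : Fin T → ℝ) (u : Fin n → ℝ) (s : ℕ),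
      (recoverLoop Q K T δ ε t r v u s).time ≤ 1 + 200 * r * (n * d * e)
  | 0, v, u, s => by simp [recoverLoop]
  | r + 1, v, u, s => by
    have h2 := recoverLoop_time Q K δ ε ht hT h1 hn hd r
    have h3 := search_time Q K T δ ε v e s t (by omega)
    simp only [recoverLoop, Cost.time_bind, tabulate_time, Cost.time_ite]
    simp only [op_val, maskedColumn_time, op_time, charge_time, readAt_time]
    have hnd : n ≤ n * d := Nat.le_mul_of_pos_right n hd
    have hnde : n * d ≤ n * d * e := Nat.le_mul_of_pos_right _ h1
    have hne : n * e ≤ n * d * e := Nat.mul_le_mul_right e hnd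
    have he : e ≤ n * e := Nat.le_mul_of_pos_left e hn
    have hTe : e * T ≤ n * e := by
      rw [mul_comm]
      exact Nat.mul_le_mul_right e hT
    calc
      _ ≤ 1 + e * (n * (9 * d + 7) + 9 * T + 20) + (1 + (1 + n * (9 * d + 7) + (1 + n * 12
          + (1 + T * 12 + (1 + n * 12 + (1 + (1 + 200 * r * (n * d * e) + 1))))))) := by
        gcongr
        · exact sum_le_mul_of_le _ fun i => (Nat.add_le_add_right (Nat.add_le_add_left
            (ite_le_add _ _ _) 1) 2).trans (by norm_num)
        · exact sum_le_mul_of_le _ fun i => by omega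
        · exact sum_le_mul_of_le _ fun i => by omega
        · exact h2 _ _ _
      _ ≤ 1 + 200 * (r + 1) * (n * d * e) := by
        have e1 : e * (n * (9 * d + 7) + 9 * T + 20)
          = 9 * (n * d * e) + 7 * (n * e) + 9 * (e * T) + 20 * e := by ring
        have e2 : n * (9 * d + 7) = 9 * (n * d) + 7 * n := by ring
        have e3 : 200 * (r + 1) * (n * d * e) = 200 * r * (n * d * e) + 200 * (n * d * e) := by ring
        omega

theorem recoverLoop_length {n d : ℕ} (Q K : Matrix (Fin n) (Fin d) ℝ) (T : ℕ) (δ ε : ℝ) (t : ℕ) :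
    ∀ (r : ℕ) (v : Fin T → ℝ) (u : Fin n → ℝ) (s : ℕ),
      (recoverLoop Q K T δ ε t r v u s).val.length = r
  | 0, v, u, s => by simp [recoverLoop]
  | r + 1, v, u, s => by
    simp [recoverLoop, recoverLoop_length Q K T δ ε t r]

theorem fst_le_of_mem_recoverLoop {n d : ℕ} (Q K : Matrix (Fin n) (Fin d) ℝ) (T : ℕ) (δ ε : ℝ)
    (t : ℕ) : ∀ (r : ℕ) (v : Fin T → ℝ) (u : Fin n → ℝ) (s : ℕ),
      ∀ p ∈ (recoverLoop Q K T δ ε t r v u s).val, p.1 ≤ n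
  | 0, v, u, s => by simp [recoverLoop]
  | r + 1, v, u, s => by
    simp only [recoverLoop, Cost.val_bind, op_val, List.mem_cons]
    rintro p (rfl | hp)
    · exact Nat.sub_le _ _
    · exact fst_le_of_mem_recoverLoop Q K T δ ε t r _ _ _ p hp

theorem expBasisTail_map_fst {n : ℕ} : ∀ (L : List (ℕ × (Fin n → ℝ))) (acc : Fin n → ℝ),
    (expBasisTail acc L).val.map Prod.fst = L.map Prod.fst
  | [], acc => rfl
  | (m, b) :: L, acc => by simp [expBasisTail, expBasisTail_map_fst L]

theorem expBasis_map_fst {n : ℕ} (L : List (ℕ × (Fin n → ℝ))) :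
    (expBasis L).val.map Prod.fst = L.map Prod.fst := by
  rcases L with _ | ⟨⟨m, b⟩, L⟩
  · rfl
  · simp [expBasis, expBasisTail_map_fst]

theorem recover_length {n d : ℕ} (Q K : Matrix (Fin n) (Fin d) ℝ) (k T : ℕ) (δ ε : ℝ) :
    (recover Q K k T δ ε).val.length = k := by
  rw [← List.length_map (f := Prod.fst)]
  simp [recover, expBasis_map_fst, recoverLoop_length]

theorem fst_le_of_mem_recover {n d : ℕ} (Q K : Matrix (Fin n) (Fin d) ℝ) (k T : ℕ) (δ ε : ℝ) :
    ∀ p ∈ (recover Q K k T δ ε).val, p.1 ≤ n := by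
  suffices ∀ m ∈ (recover Q K k T δ ε).val.map Prod.fst, m ≤ n from
    fun p hp => this _ (List.mem_map_of_mem hp)
  simp only [recover, Cost.val_bind, expBasis_map_fst]
  intro m hm
  obtain ⟨p, hp, rfl⟩ := List.mem_map.1 hm
  exact fst_le_of_mem_recoverLoop _ _ _ _ _ _ _ _ _ _ p hp

theorem expBasisTail_time {n : ℕ} : ∀ (L : List (ℕ × (Fin n → ℝ))) (acc : Fin n → ℝ),
    (expBasisTail acc L).time = 1 + L.length * (16 * n + 3)
  | [], acc => by simp [expBasisTail]
  | (m, b) :: L, acc => by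
    simp [expBasisTail, expBasisTail_time L]
    ring

theorem expBasis_time {n : ℕ} (L : List (ℕ × (Fin n → ℝ))) :
    (expBasis L).time ≤ 1 + L.length * (16 * n + 3) := by
  rcases L with _ | ⟨⟨m, b⟩, L⟩
  · simp [expBasis]
  · simp [expBasis, expBasisTail_time]
    nlinarith

theorem recover_time {n d : ℕ} (Q K : Matrix (Fin n) (Fin d) ℝ) {k T : ℕ} (δ ε : ℝ) {e : ℕ}
    (he : n < 2 ^ e) (hT : T ≤ n) (h1 : 1 ≤ e) (hn : 1 ≤ n) (hd : 1 ≤ d) (hk : 1 ≤ k) :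
    (recover Q K k T δ ε).time ≤ 300 * (k * n * d * e) := by
  simp only [recover, Cost.time_bind, tabulate_time, op_time]
  simp only [op_val, Finset.sum_const, Finset.card_univ, Fintype.card_fin, smul_eq_mul]
  have h2 := expBasis_time (recoverLoop Q K T δ ε (n - T) k (tabulate T fun _ => op 0).val
    (tabulate n fun _ => op 0).val 0).val
  have h3 := recoverLoop_time Q K δ ε (lt_of_le_of_lt (Nat.sub_le n T) he) hT h1 hn hd k
    (tabulate T fun _ => op 0).val (tabulate n fun _ => op 0).val 0
  rw [recoverLoop_length] at h2
  have hnk : n ≤ k * n := Nat.le_mul_of_pos_left n hk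
  have hkk : k ≤ k * n := Nat.le_mul_of_pos_right k hn
  have hall : k * n ≤ k * n * d * e := by
    rw [mul_assoc]
    exact Nat.le_mul_of_pos_right _ (Nat.mul_pos hd h1)
  have e1 : k * (16 * n + 3) = 16 * (k * n) + 3 * k := by ring
  have e2 : 200 * k * (n * d * e) = 200 * (k * n * d * e) := by ring
  omega

theorem convForward_time {n d : ℕ} (Q K V : Matrix (Fin n) (Fin d) ℝ) {k T : ℕ} (δ ε : ℝ) {e : ℕ}
    (he : n < 2 ^ e) (hT : T ≤ n) (h1 : 1 ≤ e) (hn : 1 ≤ n) (hd : 1 ≤ d) (hk : 1 ≤ k) :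
    (convForward Q K V k T δ ε).time ≤ 4000 * (k * n * d * e) := by
  have h2 := recover_time Q K δ ε he hT h1 hn hd hk
  have h3 := fun x => applyBasis_time x he h1 hn _ (fst_le_of_mem_recover Q K k T δ ε)
  simp only [recover_length] at h3
  simp only [convForward, approxNormalizer, Cost.time_bind, tabulate_time, op_time, readAt_time,
    readAt₂_time, readAt₂_matrix_time]
  have hne : n ≤ n * e := Nat.le_mul_of_pos_right n h1
  have hnk : n * e ≤ k * (n * e) := Nat.le_mul_of_pos_left _ hk
  have hall : k * (n * e) ≤ k * n * d * e := by
    rw [mul_right_comm, mul_assoc k]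
    exact Nat.le_mul_of_pos_right _ hd
  have hdn : d * (k * (n * e)) = k * n * d * e := by ring
  have hdne : d * (n * e) ≤ d * (k * (n * e)) := Nat.mul_le_mul_left d hnk
  have hn' : d * n ≤ d * (n * e) := Nat.mul_le_mul_left d hne
  have hd' : d ≤ d * n := Nat.le_mul_of_pos_right d hn
  calc
    _ ≤ 300 * (k * n * d * e) + (1 + n * 3 + (1510 * k + 10) * (n * e)
        + (1 + d * (1 + n * 5 + (1510 * k + 10) * (n * e) + 2)
        + (1 + n * (1 + d * 8 + 2)))) := by
      gcongr
      · exact sum_le_mul_of_le _ fun i => by omega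
      · exact h3 _
      · refine sum_le_mul_of_le _ fun i => ?_
        gcongr
        · exact sum_le_mul_of_le _ fun i => by omega
        · exact h3 _
      · refine sum_le_mul_of_le _ fun i => ?_
        gcongr
        exact sum_le_mul_of_le _ fun i => by omega
    _ ≤ 4000 * (k * n * d * e) := by
      have e1 : (1510 * k + 10) * (n * e) = 1510 * (k * (n * e)) + 10 * (n * e) := by ring
      have e2 : d * (1 + n * 5 + (1510 * (k * (n * e)) + 10 * (n * e)) + 2)
        = 3 * d + 5 * (d * n) + 1510 * (d * (k * (n * e))) + 10 * (d * (n * e)) := by ring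
      have e3 : n * (1 + d * 8 + 2) = 3 * n + 8 * (d * n) := by ring
      rw [e1, e2, e3]
      omega


/-! ## Correctness of the recovery -/

/-- Entry `l` of column `j` of `G`, counted from the diagonal; `0` outside the matrix. -/
def score {n : ℕ} (G : Matrix (Fin n) (Fin n) ℝ) (j l : ℕ) : ℝ :=
  if h : j + l < n then G ⟨j + l, h⟩ ⟨j, by omega⟩ else 0

theorem score_sub {n : ℕ} (G : Matrix (Fin n) (Fin n) ℝ) {a c : Fin n} (h : (c : ℕ) ≤ a) :
    score G c ((a : ℕ) - c) = G a c := by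
  have h1 : (c : ℕ) + (a - c) = a := by omega
  have h2 : (c : ℕ) + (a - c) < n := by omega
  rw [score, dif_pos h2]
  congr 1
  exact Fin.ext h1

/-- No range hypothesis is needed, since both sides take the default value `0` outside the matrix.
-/
theorem readAt_maskedColumn {n d : ℕ} (Q K : Matrix (Fin n) (Fin d) ℝ) (j l : ℕ) :
    (readAt (maskedColumn Q K j).val (j + l)).val = score (maskedScores Q K) j l := by
  by_cases h : j + l < n
  · have hj : j < n := by omega
    rw [readAt_val_of_lt _ h, score, dif_pos h]
    simp only [maskedColumn, tabulate_val, Cost.val_bind, sumLoop_val, op_val]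
    have hQ : ∀ x : Fin d, (readAt₂ Q (j + l) x).val = Q ⟨j + l, h⟩ x :=
      fun x => readAt₂_val_of_lt Q h x.isLt
    have hK : ∀ x : Fin d, (readAt₂ K j x).val = K ⟨j, hj⟩ x :=
      fun x => readAt₂_val_of_lt K hj x.isLt
    have hM : (readAt₂ (causalMask n) (j + l) j).val = causalMask n ⟨j + l, h⟩ ⟨j, hj⟩ :=
      readAt₂_val_of_lt _ h hj
    simp [hQ, hK, hM, maskedScores, Matrix.mul_apply]
  · simp [readAt, score, h]

/-- Binary search for a monotone predicate. The test is constrained only for `j < t`, since the end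
`t` is returned without being tested; so `x = t` is allowed. -/
theorem search_val {n d : ℕ} (Q K : Matrix (Fin n) (Fin d) ℝ) (T : ℕ) (δ ε : ℝ)
    (v : Fin T → ℝ) (x s t : ℕ) (hs : s ≤ x) (ht : x ≤ t)
    (h : ∀ j, s ≤ j → j < t →
      (δ - 2 * T * ε ≤ ∑ l : Fin T, |score (maskedScores Q K) j l - v l| ↔ x ≤ j)) :
    (search Q K T δ ε v s t).val = x := by
  induction hr : t - s using Nat.strong_induction_on generalizing s t with
  | _ r ih =>
    rw [search]
    split_ifs with hst
    · simp
      omega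
    simp only [Cost.val_bind, Cost.val_ite]
    simp only [op_val, sumLoop_val, Cost.val_bind, readAt_maskedColumn, readAt_val_fin]
    have hj := h ((s + t) / 2) (by omega) (by omega)
    split_ifs with hc
    · exact ih _ (by omega) s ((s + t) / 2) hs (hj.1 hc)
        (fun j h1 h2 => h j h1 (by omega)) rfl
    · have hx : ¬ x ≤ (s + t) / 2 := fun hx => hc (hj.2 hx)
      exact ih _ (by omega) ((s + t) / 2 + 1) t (by omega) ht
        (fun j h1 h2 => h j (by omega) h2) rfl

/-- Column `j` of `G` is within `ε` of the sum of the `β_q` with position `pos q ≤ j`, and sums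
of consecutive `β_q` are far enough from zero to be detected. -/
structure IsSeparated {n k : ℕ} (G : Matrix (Fin n) (Fin n) ℝ) (T : ℕ) (δ ε : ℝ)
    (pos : Fin k → ℕ) (β : Fin k → ℕ → ℝ) : Prop where
  strictMono : StrictMono pos
  pos_add_le : ∀ q, pos q + T ≤ n
  close : ∀ j l, j + l < n →
    |score G j l - ∑ q ∈ Finset.univ.filter (fun q => pos q ≤ j), β q l| ≤ ε
  le_norm : ∀ i p : Fin k, i ≤ p → δ ≤ ∑ l : Fin T, |∑ q ∈ Finset.Icc i p, β q l|
  gap : 4 * T * ε < δ ∨ ∀ q, pos q = q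

namespace IsSeparated

variable {n k T : ℕ} {δ ε : ℝ} {G : Matrix (Fin n) (Fin n) ℝ} {pos : Fin k → ℕ}
  {β : Fin k → ℕ → ℝ}

theorem filter_eq_Iio (h : IsSeparated G T δ ε pos β) {i : Fin k} {j : ℕ} (hj : j < pos i)
    (hlt : ∀ q < i, pos q ≤ j) :
    Finset.univ.filter (fun q => pos q ≤ j) = Finset.Iio i := by
  ext q
  simp only [Finset.mem_filter, Finset.mem_univ, true_and, Finset.mem_Iio]
  exact ⟨fun hq => h.strictMono.lt_iff_lt.1 (lt_of_le_of_lt hq hj), hlt q⟩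

theorem filter_eq_Iic (h : IsSeparated G T δ ε pos β) {p : Fin k} {j : ℕ} (hp : pos p ≤ j)
    (hmax : ∀ q, pos q ≤ j → q ≤ p) :
    Finset.univ.filter (fun q => pos q ≤ j) = Finset.Iic p := by
  ext q
  simp only [Finset.mem_filter, Finset.mem_univ, true_and, Finset.mem_Iic]
  exact ⟨hmax q, fun hq => (h.strictMono.monotone hq).trans hp⟩

theorem exists_max {pos : Fin k → ℕ} {i : Fin k} {j : ℕ} (hi : pos i ≤ j) :
    ∃ p, i ≤ p ∧ pos p ≤ j ∧ ∀ q, pos q ≤ j → q ≤ p := by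
  obtain ⟨p, hp, hmax⟩ := (Finset.univ.filter (fun q => pos q ≤ j)).exists_max_image id
    ⟨i, by simpa using hi⟩
  refine ⟨p, hmax i (by simpa using hi), by simpa using hp, fun q hq => hmax q (by simpa using hq)⟩

/-- The test of the binary search detects whether the next basis vector has started. -/
theorem test_iff (h : IsSeparated G T δ ε pos β) {i : Fin k} {v : Fin T → ℝ}
    (hv : ∀ l, |v l - ∑ q ∈ Finset.Iio i, β q l| ≤ ε) {s j : ℕ} (hs : ∀ q < i, pos q < s)
    (hsj : s ≤ j) (hj : j + T ≤ n) :
    δ - 2 * T * ε ≤ ∑ l : Fin T, |score G j l - v l| ↔ pos i ≤ j := by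
  constructor
  · intro htest
    by_contra hlt
    rw [not_le] at hlt
    rcases h.gap with hgap | hgap
    -- Before the next position, the column and `v` approximate the same partial sum, each up to
    -- `ε`.
    · have hle : ∑ l : Fin T, |score G j l - v l| ≤ ∑ _l : Fin T, 2 * ε := by
        refine Finset.sum_le_sum fun l _ => ?_
        have h1 := h.close j l (by omega)
        rw [h.filter_eq_Iio hlt fun q hq => (hs q hq).le.trans hsj] at h1
        have h2 := hv l
        rw [abs_le] at h1 h2 ⊢
        constructor <;> linarith
      simp only [Finset.sum_const, Finset.card_univ, Fintype.card_fin, nsmul_eq_mul] at hle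
      linarith
    -- When the positions are `0, 1, …`, an index `j < pos i` is itself an earlier position, hence
    -- below `s`.
    · rw [hgap] at hlt
      have := hs ⟨j, hlt.trans i.isLt⟩ hlt
      rw [hgap] at this
      simp only at this
      omega
  · intro hij
    -- A tested column may lie beyond several new positions. It then differs from `v` by about the
    -- whole block `i, …, p`, which is why non-degeneracy is needed for sums of consecutive vectors.
    obtain ⟨p, hip, hpj, hmax⟩ := exists_max hij
    have hle : ∑ l : Fin T, |∑ q ∈ Finset.Icc i p, β q l|
        ≤ ∑ l : Fin T, (2 * ε + |score G j l - v l|) := by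
      refine Finset.sum_le_sum fun l _ => ?_
      have h1 := h.close j l (by omega)
      rw [h.filter_eq_Iic hpj hmax] at h1
      have h2 := hv l
      have h3 : ∑ q ∈ Finset.Iic p, β q l
          = ∑ q ∈ Finset.Iio i, β q l + ∑ q ∈ Finset.Icc i p, β q l := by
        rw [← Finset.sum_union]
        · congr 1
          ext q
          simp only [Finset.mem_union, Finset.mem_Iio, Finset.mem_Icc, Finset.mem_Iic]
          constructor
          · intro hq
            rcases lt_or_ge q i with h | h
            · exact Or.inl h
            · exact Or.inr ⟨h, hq⟩
          · rintro (hq | hq)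
            · exact hq.le.trans hip
            · exact hq.2
        · rw [Finset.disjoint_left]
          intro q hq hq'
          exact absurd (Finset.mem_Iio.1 hq) (not_lt.2 (Finset.mem_Icc.1 hq').1)
      have h4 := abs_le.1 (le_refl |score G j l - v l|)
      rw [abs_le] at h1 h2 ⊢
      constructor <;> linarith
    have hδ := h.le_norm i p hip
    rw [Finset.sum_add_distrib] at hle
    simp only [Finset.sum_const, Finset.card_univ, Fintype.card_fin, nsmul_eq_mul] at hle
    linarith

end IsSeparated

/-! ### Unfolding one round of the recovery and of the exponentiation. -/

theorem recoverLoop_succ_val {n d : ℕ} (Q K : Matrix (Fin n) (Fin d) ℝ) (T : ℕ) (δ ε : ℝ)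
    (t r : ℕ) (v : Fin T → ℝ) (u : Fin n → ℝ) (s x : ℕ)
    (hx : (search Q K T δ ε v s t).val = x) (b : Fin n → ℝ)
    (hb : b = fun l : Fin n =>
      if (l : ℕ) < n - x then score (maskedScores Q K) x l - u l else 0) :
    (recoverLoop Q K T δ ε t (r + 1) v u s).val
      = (n - x, b) :: (recoverLoop Q K T δ ε t r (fun l => v l + (readAt b l).val)
          (fun l => u l + b l) (x + 1)).val := by
  have hcol : (tabulate n fun l : Fin n => do
      charge 1
      if (l : ℕ) < n - x then do
        let i ← op (x + (l : ℕ))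
        let x ← readAt (maskedColumn Q K x).val i
        let y ← readAt u l
        op (x - y)
      else op 0).val = b := by
    subst hb
    funext l
    simp [readAt_maskedColumn]
  have hv : ∀ b : Fin n → ℝ, (tabulate T fun l : Fin T => do
      let x ← readAt v l
      let y ← readAt b l
      op (x + y)).val = fun l => v l + (readAt b l).val := by
    intro b
    funext l
    simp
  have hu : ∀ b : Fin n → ℝ, (tabulate n fun l : Fin n => do
      let x ← readAt u l
      let y ← readAt b l
      op (x + y)).val = fun l => u l + b l := by
    intro b
    funext l
    simp
  simp only [recoverLoop, Cost.val_bind, hx]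
  simp only [op_val]
  erw [hcol]
  rw [hv, hu]

theorem expBasisTail_cons_val {n : ℕ} (acc : Fin n → ℝ) (m : ℕ) (b : Fin n → ℝ)
    (L : List (ℕ × (Fin n → ℝ))) :
    (expBasisTail acc ((m, b) :: L)).val
      = (m, fun i => Real.exp (acc i + b i) - Real.exp (acc i))
        :: (expBasisTail (fun i => acc i + b i) L).val := by
  have h1 : (tabulate n fun i => do
      let x ← readAt acc i
      let y ← readAt b i
      op (x + y)).val = fun i => acc i + b i := by
    funext i
    simp
  have h2 : ∀ acc' : Fin n → ℝ, (tabulate n fun i => do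
      let x ← readAt acc' i
      let y ← readAt acc i
      let ex ← op (Real.exp x)
      let ey ← op (Real.exp y)
      op (ex - ey)).val = fun i => Real.exp (acc' i) - Real.exp (acc i) := by
    intro acc'
    funext i
    simp
  simp [expBasisTail, h1, h2]

theorem expBasis_cons_val {n : ℕ} (m : ℕ) (b : Fin n → ℝ) (L : List (ℕ × (Fin n → ℝ))) :
    (expBasis ((m, b) :: L)).val = (m, fun i => Real.exp (b i)) :: (expBasisTail b L).val := by
  have h1 : (tabulate n fun i => do
      let x ← readAt b i
      op (Real.exp x)).val = fun i => Real.exp (b i) := by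
    funext i
    simp
  simp [expBasis, h1]

theorem basisMatrix_of_lt {n : ℕ} {a c : Fin n} (h : (a : ℕ) < c) :
    ∀ L : List (ℕ × (Fin n → ℝ)), basisMatrix L a c = 0
  | [] => rfl
  | (m, b) :: L => by
    rw [basisMatrix, Matrix.add_apply, subConv_of_notMem b (by omega), basisMatrix_of_lt h L,
      zero_add]

/-- What the remaining `r` rounds contribute to entry `(a, c)` of the approximate matrix. -/
theorem basisMatrix_expBasisTail_recoverLoop {n d k T : ℕ} {δ ε : ℝ}
    (Q K : Matrix (Fin n) (Fin d) ℝ) {pos : Fin k → ℕ} {β : Fin k → ℕ → ℝ}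
    (h : IsSeparated (maskedScores Q K) T δ ε pos β) {a c : Fin n} (hac : (c : ℕ) ≤ a) :
    ∀ (r i : ℕ) (v : Fin T → ℝ) (u : Fin n → ℝ) (s : ℕ), i + r = k →
      (∀ l : Fin T, |v l - ∑ q ∈ Finset.univ.filter (fun q : Fin k => (q : ℕ) < i), β q l| ≤ ε) →
      (∀ l : Fin T, v l = (readAt u l).val) →
      (∀ q : Fin k, (q : ℕ) < i → pos q < s) → (∀ q : Fin k, i ≤ q → s ≤ pos q) →
      (∀ p : Fin k, i ≤ p → pos p ≤ c → (∀ q, pos q ≤ c → q ≤ p) →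
        basisMatrix (expBasisTail u (recoverLoop Q K T δ ε (n - T) r v u s).val).val a c
          = Real.exp (score (maskedScores Q K) (pos p) ((a : ℕ) - c))
            - Real.exp (readAt u ((a : ℕ) - c)).val) ∧
      ((∀ q : Fin k, i ≤ q → (c : ℕ) < pos q) →
        basisMatrix (expBasisTail u (recoverLoop Q K T δ ε (n - T) r v u s).val).val a c = 0)
  | 0, i, v, u, s, hik, hv, hvu, hs, hs' => by
    refine ⟨fun p hp => ?_, fun _ => rfl⟩
    have := p.isLt
    omega
  | r + 1, i, v, u, s, hik, hv, hvu, hs, hs' => by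
    have hi : i < k := by omega
    have hIio : ∀ j : Fin k, Finset.univ.filter (fun q : Fin k => (q : ℕ) < j) = Finset.Iio j := by
      intro j
      ext q
      simp
    have hIic : Finset.univ.filter (fun q : Fin k => (q : ℕ) < i + 1)
        = Finset.univ.filter (fun q => pos q ≤ pos ⟨i, hi⟩) := by
      ext q
      simp [h.strictMono.le_iff_le, Fin.le_def]
    have hx := search_val Q K T δ ε v (pos ⟨i, hi⟩) s (n - T) (hs' _ le_rfl)
      (Nat.le_sub_of_add_le (h.pos_add_le _))
      fun j h1 h2 => h.test_iff (i := ⟨i, hi⟩) (by rw [← hIio]; exact hv)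
        (fun q hq => hs q hq) h1 (by omega)
    set x := pos ⟨i, hi⟩ with hxdef
    have hxT := h.pos_add_le ⟨i, hi⟩
    rw [recoverLoop_succ_val Q K T δ ε (n - T) r v u s x hx _ rfl, expBasisTail_cons_val,
      basisMatrix, Matrix.add_apply]
    set b : Fin n → ℝ := fun l : Fin n =>
      if (l : ℕ) < n - x then score (maskedScores Q K) x l - u l else 0 with hb
    have hread : ∀ l, l < n - x → (readAt b l).val
        = score (maskedScores Q K) x l - (readAt u l).val := by
      intro l hl
      have hl' : l < n := by omega
      rw [readAt_val_of_lt _ hl', readAt_val_of_lt _ hl', hb]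
      simp [hl]
    have hadd : ∀ l, (readAt (fun l => u l + b l) l).val = (readAt u l).val + (readAt b l).val := by
      intro l
      by_cases hl : l < n
      · rw [readAt_val_of_lt _ hl, readAt_val_of_lt _ hl, readAt_val_of_lt _ hl]
      · simp [readAt, hl]
    obtain ⟨ih1, ih2⟩ := basisMatrix_expBasisTail_recoverLoop Q K h hac r (i + 1)
      (fun l => v l + (readAt b l).val) (fun l => u l + b l) (x + 1) (by omega)
      (by
        intro l
        -- The old `u` cancels: the new `v` is exactly the column at `x`, so its error is a single
        -- `ε` whatever the number of rounds.
        rw [hread l (by omega), hvu, add_sub_cancel, hIic]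
        exact h.close x l (by omega))
      (by
        intro l
        rw [hadd, hvu])
      (by
        intro q hq
        have : pos q ≤ x := h.strictMono.monotone (by rw [Fin.le_def]; simp only; omega)
        omega)
      (by
        intro q hq
        exact h.strictMono (by rw [Fin.lt_def]; simp only; omega))
    have hconv : x ≤ c → subConv (fun l => Real.exp (u l + b l) - Real.exp (u l)) (n - x) a c
        = Real.exp (score (maskedScores Q K) x ((a : ℕ) - c))
          - Real.exp (readAt u ((a : ℕ) - c)).val := by
      intro hxc
      have hl : (a : ℕ) - c < n := by omega
      rw [subConv_of_mem _ ⟨by omega, hac⟩, readAt_val_of_lt _ hl, readAt_val_of_lt _ hl, hb]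
      have : (a : ℕ) - c < n - x := by omega
      simp [this]
    constructor
    · intro p hip hpc hmax
      have hxc : x ≤ c := (h.strictMono.monotone (by rw [Fin.le_def]; exact hip)).trans hpc
      rw [hconv hxc]
      -- If `p` comes later, the remaining rounds start from the exponential of the column at `x`
      -- and the sum telescopes. If `p` is this round, all later blocks begin to the right of `c`.
      rcases Nat.lt_or_ge i p with hlt | hge
      · rw [ih1 p hlt hpc hmax, hadd, hread _ (by omega), add_sub_cancel]
        ring
      · have hpi : p = ⟨i, hi⟩ := Fin.ext (by simp only; omega)
        rw [ih2, hpi, add_zero]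
        intro q hq
        by_contra hcq
        have := Fin.le_def.1 (hmax q (not_lt.1 hcq))
        omega
    · intro hc
      have := hc ⟨i, hi⟩ le_rfl
      rw [ih2 fun q hq => hc q (by omega), subConv_of_notMem _ (by omega), add_zero]

/-- The first vector is `exp b` rather than `exp b - exp 0`. The correction `1` lets the induction
treat all rounds alike, starting from the zero sum. -/
theorem basisMatrix_expBasis_cons {n : ℕ} (m : ℕ) (b : Fin n → ℝ) (L : List (ℕ × (Fin n → ℝ)))
    {a c : Fin n} (h : n - m ≤ (c : ℕ) ∧ (c : ℕ) ≤ a) :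
    basisMatrix (expBasis ((m, b) :: L)).val a c
      = basisMatrix (expBasisTail (fun _ => 0) ((m, b) :: L)).val a c + 1 := by
  have hl : (a : ℕ) - c < n := by omega
  simp only [expBasis_cons_val, expBasisTail_cons_val, basisMatrix, Matrix.add_apply,
    subConv_of_mem _ h, readAt_val_of_lt _ hl, zero_add, Real.exp_zero]
  ring

/-- Every column of the approximate matrix is the exponential of the shifted column of `H̃` at
the last position that does not exceed it. -/
theorem basisMatrix_recover {n d k T : ℕ} {δ ε : ℝ} (Q K : Matrix (Fin n) (Fin d) ℝ)
    {pos : Fin k → ℕ} {β : Fin k → ℕ → ℝ}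
    (h : IsSeparated (maskedScores Q K) T δ ε pos β) (hε : 0 ≤ ε) (hk : 0 < k)
    (h0 : pos ⟨0, hk⟩ = 0) {a c : Fin n} (hac : (c : ℕ) ≤ a) :
    ∃ p, pos p ≤ c ∧ (∀ q, pos q ≤ c → q ≤ p) ∧
      basisMatrix (recover Q K k T δ ε).val a c
        = Real.exp (score (maskedScores Q K) (pos p) ((a : ℕ) - c)) := by
  obtain ⟨p, -, hpc, hmax⟩ := IsSeparated.exists_max (pos := pos) (i := ⟨0, hk⟩) (j := c)
    (by omega)
  refine ⟨p, hpc, hmax, ?_⟩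
  obtain ⟨r, rfl⟩ : ∃ r, k = r + 1 := ⟨k - 1, by omega⟩
  have hv : (tabulate T fun _ => op (0 : ℝ)).val = fun _ => 0 := by
    funext i
    simp
  have hu : (tabulate n fun _ => op (0 : ℝ)).val = fun _ => 0 := by
    funext i
    simp
  have hl : (a : ℕ) - c < n := by omega
  have key := (basisMatrix_expBasisTail_recoverLoop Q K h hac (r + 1) 0 (fun _ => 0) (fun _ => 0) 0
    (zero_add _) (by simpa using fun _ => hε) (fun l => by simp [readAt]) (fun q hq => by omega)
    (fun q _ => Nat.zero_le _)).1 p (Nat.zero_le _) hpc hmax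
  -- The first block must start in column `0`, so that the correction `1` reaches every column and
  -- cancels the `- exp 0` in `key`.
  have hx : (search Q K T δ ε (fun _ => 0) 0 (n - T)).val = 0 := by
    refine (search_val Q K T δ ε _ (pos ⟨0, hk⟩) _ _ (Nat.zero_le _)
      (Nat.le_sub_of_add_le (h.pos_add_le _)) ?_).trans h0
    have hT := h.pos_add_le ⟨0, hk⟩
    refine fun j h1 h2 => h.test_iff (fun l => ?_) (fun q hq => ?_) h1 (by omega)
    · have : Finset.Iio (⟨0, hk⟩ : Fin (r + 1)) = ∅ := by
        ext q
        simp
      rw [this]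
      simpa using hε
    · exact absurd (Fin.lt_def.1 hq) (Nat.not_lt_zero _)
  simp only [recover, Cost.val_bind, hv, hu]
  simp only [op_val]
  rw [recoverLoop_succ_val Q K T δ ε (n - T) r _ _ 0 0 hx _ rfl] at key ⊢
  rw [basisMatrix_expBasis_cons _ _ _ ⟨by omega, hac⟩, key, readAt_val_of_lt _ hl, Real.exp_zero]
  ring


/-! ## Error analysis -/

/-- A strictly increasing self-map of a finite chain is the identity. This pins down the positions
when `k = n + 1 - T`. -/
theorem eq_val_of_strictMono {k : ℕ} {f : Fin k → ℕ} (hf : StrictMono f) (hlt : ∀ q, f q < k)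
    (q : Fin k) : f q = q := by
  have hg : StrictMono fun q => (⟨f q, hlt q⟩ : Fin k) := fun a b hab => hf hab
  exact congrArg Fin.val (le_antisymm hg.apply_le hg.le_apply)

theorem score_subConv {n : ℕ} (b : Fin n → ℝ) (m : ℕ) {j l : ℕ} (h : j + l < n) :
    score (subConv b m) j l = if n - m ≤ j then (readAt b l).val else 0 := by
  rw [score, dif_pos h]
  split_ifs with hm
  · rw [subConv_of_mem _ ⟨hm, by simp⟩]
    simp
  · exact subConv_of_notMem _ (by simp [hm])

theorem IsCloseNonDegenerate.isSeparated {n k T : ℕ} {δ ε : ℝ} {b : Fin k → Fin n → ℝ}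
    {m : Fin k → ℕ} {G : Matrix (Fin n) (Fin n) ℝ} (h : IsCloseNonDegenerate T δ ε b m G)
    (hδ : 0 < δ ∨ k = n + 1 - T) :
    IsSeparated G T δ ε (fun q => n - m q) (fun q l => (readAt (b q) l).val) := by
  obtain ⟨hb, R, hG, hR, hε⟩ := h
  have hT : (0 : ℝ) < T := by exact_mod_cast hb.one_le_T
  have hmono : StrictMono fun q => n - m q := by
    intro p q hpq
    have h1 := hb.strictAnti hpq
    have h2 := hb.m_le p
    simp only
    omega
  have hle : ∀ q, n - m q + T ≤ n := by
    intro q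
    have h1 := hb.T_le_m q
    have h2 := hb.m_le q
    omega
  refine ⟨hmono, hle, ?_, ?_, ?_⟩
  · intro j l hjl
    have hR' : |R ⟨j + l, hjl⟩ ⟨j, by omega⟩| ≤ ε :=
      (Matrix.norm_entry_le_entrywise_sup_norm R).trans hR
    have hsum : score G j l = ∑ q, score (subConv (b q) (m q)) j l
        + R ⟨j + l, hjl⟩ ⟨j, by omega⟩ := by
      simp only [score, dif_pos hjl, hG, Matrix.add_apply, Matrix.sum_apply]
    rw [hsum, Finset.sum_filter, Finset.sum_congr rfl fun q _ => score_subConv (b q) (m q) hjl,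
      add_sub_cancel_left]
    exact hR'
  · intro i p hip
    refine (hb.le_norm p i hip).trans_eq ?_
    have hf : ∀ t : Fin n, (if (t : ℕ) < T then |∑ l ∈ Finset.Icc i p, b l t| else 0)
        = (fun t : ℕ => if t < T then |∑ l ∈ Finset.Icc i p, (readAt (b l) t).val| else 0) t := by
      intro t
      simp
    rw [Finset.sum_congr rfl fun t _ => hf t, Fin.sum_univ_eq_sum_range (fun t : ℕ =>
      if t < T then |∑ l ∈ Finset.Icc i p, (readAt (b l) t).val| else 0) n,
      Fin.sum_univ_eq_sum_range (fun t : ℕ => |∑ l ∈ Finset.Icc i p, (readAt (b l) t).val|) T,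
      ← Finset.sum_filter]
    refine Finset.sum_congr ?_ fun _ _ => rfl
    ext t
    have := hb.T_le
    simp only [Finset.mem_filter, Finset.mem_range]
    omega
  · rcases hδ with hδ | hk
    -- From `5Tε ≤ δ` the bound `4Tε ≤ 4δ/5` follows, and it is below `δ` only because `δ > 0`.
    · left
      rw [le_div_iff₀ (by positivity)] at hε
      linarith
    · right
      have hTn := hb.T_le
      refine eq_val_of_strictMono hmono fun q => ?_
      have := hle q
      omega

/-! ### Attention as a weighted average, and its perturbation. -/

theorem attnMatrix_apply {n d : ℕ} (Q K : Matrix (Fin n) (Fin d) ℝ) (i j : Fin n) :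
    attnMatrix Q K i j = if j ≤ i then Real.exp (maskedScores Q K i j) else 0 := by
  simp only [attnMatrix, maskedScores, causalMask, Matrix.hadamard_apply, Matrix.of_apply,
    Matrix.map_apply]
  split_ifs <;> simp

theorem attnMatrix_nonneg {n d : ℕ} (Q K : Matrix (Fin n) (Fin d) ℝ) (i j : Fin n) :
    0 ≤ attnMatrix Q K i j := by
  rw [attnMatrix_apply]
  split_ifs
  · positivity
  · rfl

theorem attnMatrix_sum_pos {n d : ℕ} (Q K : Matrix (Fin n) (Fin d) ℝ) (i : Fin n) :
    0 < ∑ j, attnMatrix Q K i j := by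
  refine Finset.sum_pos' (fun j _ => attnMatrix_nonneg Q K i j) ⟨i, Finset.mem_univ _, ?_⟩
  rw [attnMatrix_apply, if_pos le_rfl]
  positivity

theorem exactAttention_apply {n d : ℕ} (Q K V : Matrix (Fin n) (Fin d) ℝ) (i : Fin n)
    (c : Fin d) :
    exactAttention Q K V i c = (∑ j, attnMatrix Q K i j * V j c) / ∑ j, attnMatrix Q K i j := by
  have hinv : (attnNormalizer Q K)⁻¹
      = Matrix.diagonal fun i => (∑ j, attnMatrix Q K i j)⁻¹ := by
    refine Matrix.inv_eq_right_inv ?_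
    rw [attnNormalizer, Matrix.diagonal_mul_diagonal, ← Matrix.diagonal_one]
    congr 1
    funext i
    simp only [Matrix.mulVec, dotProduct, Pi.one_apply, mul_one]
    exact mul_inv_cancel₀ (attnMatrix_sum_pos Q K i).ne'
  rw [exactAttention, hinv, Matrix.mul_assoc, Matrix.diagonal_mul, Matrix.mul_apply,
    inv_mul_eq_div]

theorem abs_weighted_average_sub_le {ι : Type*} [Fintype ι] {A B V : ι → ℝ} {η M : ℝ}
    (hA : 0 < ∑ j, A j) (hB : 0 < ∑ j, B j) (hB0 : ∀ j, 0 ≤ B j)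
    (hAB : ∀ j, |A j - B j| ≤ η * A j) (hV : ∀ j, |V j| ≤ M) (hM : 0 ≤ M) :
    |(∑ j, A j * V j) / (∑ j, A j) - (∑ j, B j * V j) / ∑ j, B j| ≤ 2 * η * M := by
  have h1 : |∑ j, (A j - B j) * V j| ≤ η * (∑ j, A j) * M := by
    rw [Finset.mul_sum, Finset.sum_mul]
    refine (Finset.abs_sum_le_sum_abs _ _).trans (Finset.sum_le_sum fun j _ => ?_)
    rw [abs_mul]
    exact mul_le_mul (hAB j) (hV j) (abs_nonneg _) ((abs_nonneg _).trans (hAB j))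
  have h2 : |(∑ j, B j * V j) / ∑ j, B j| ≤ M := by
    rw [abs_div, abs_of_pos hB, div_le_iff₀ hB, Finset.mul_sum]
    refine (Finset.abs_sum_le_sum_abs _ _).trans (Finset.sum_le_sum fun j _ => ?_)
    rw [abs_mul, abs_of_nonneg (hB0 j), mul_comm]
    exact mul_le_mul_of_nonneg_right (hV j) (hB0 j)
  have h3 : |∑ j, B j - ∑ j, A j| ≤ η * ∑ j, A j := by
    rw [← Finset.sum_sub_distrib, Finset.mul_sum]
    refine (Finset.abs_sum_le_sum_abs _ _).trans (Finset.sum_le_sum fun j _ => ?_)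
    rw [abs_sub_comm]
    exact hAB j
  -- One `η * M` comes from changing the weights in the numerator, the other from changing the
  -- normalizer, which multiplies a `B`-average bounded by `M`.
  have h4 : (∑ j, A j * V j) / (∑ j, A j) - (∑ j, B j * V j) / ∑ j, B j
      = (∑ j, (A j - B j) * V j
        + (∑ j, B j * V j) / (∑ j, B j) * (∑ j, B j - ∑ j, A j)) / ∑ j, A j := by
    simp only [sub_mul, Finset.sum_sub_distrib]
    field_simp
    ring
  rw [h4, abs_div, abs_of_pos hA, div_le_iff₀ hA]
  refine (abs_add_le _ _).trans ?_
  rw [abs_mul]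
  have h5 := mul_le_mul h2 h3 (abs_nonneg _) hM
  linarith

/-- The ratio of the exponentials lies between `exp (-η)` and `exp η`, and `1 - exp (-η) ≤ exp η -
1`. -/
theorem abs_exp_sub_exp_le {x y η : ℝ} (h : |x - y| ≤ η) :
    |Real.exp x - Real.exp y| ≤ (Real.exp η - 1) * Real.exp x := by
  rw [abs_le] at h
  have h1 : Real.exp y ≤ Real.exp η * Real.exp x := by
    rw [← Real.exp_add]
    exact Real.exp_le_exp.2 (by linarith)
  have h2 : Real.exp x ≤ Real.exp η * Real.exp y := by
    rw [← Real.exp_add]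
    exact Real.exp_le_exp.2 (by linarith)
  have h3 : 1 ≤ Real.exp η := Real.one_le_exp (by linarith)
  have h4 := Real.exp_pos y
  have h5 := Real.exp_pos x
  rw [abs_le]
  constructor
  · linarith
  · rcases le_total (Real.exp x) (Real.exp y) with h6 | h6
    · nlinarith
    · nlinarith

/-- For `n ≥ 2` the added `1` at most doubles the integer logarithm, and `log 2 > 1/2` accounts for
the other factor `2`. -/
theorem natLog_two_add_one_le {n : ℕ} (hn : 2 ≤ n) :
    ((Nat.log 2 n + 1 : ℕ) : ℝ) ≤ 4 * Real.log n := by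
  have h1 : 1 ≤ Nat.log 2 n := Nat.log_pos (by norm_num) hn
  have h2 : ((Nat.log 2 n : ℕ) : ℝ) * Real.log 2 ≤ Real.log n := by
    rw [← Real.log_pow]
    refine Real.log_le_log (by positivity) ?_
    exact_mod_cast Nat.pow_log_le_self 2 (by omega)
  have h3 := Real.log_two_gt_d9
  have h4 : (1 : ℝ) ≤ Nat.log 2 n := by exact_mod_cast h1
  push_cast
  nlinarith

end ConvAttention
end

open ConvAttention in
theorem theorem4p3 :
    ∃ C : ℝ, 0 < C ∧
      ∀ (n d k T : ℕ) (δ ε : ℝ) (Q K V : Matrix (Fin n) (Fin d) ℝ)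
        (b : Fin k → Fin n → ℝ) (m : Fin k → ℕ),
        IsCloseNonDegenerate T δ ε b m (maskedScores Q K) →
        (∀ i : Fin k, (i : ℕ) = 0 → m i = n) →
        (0 < δ ∨ k = n + 1 - T) →
        (∀ i, (approxNormalizer (recover Q K k T δ ε).val).val i ≠ 0) ∧
        ‖exactAttention Q K V - (convForward Q K V k T δ ε).val‖
          ≤ 2 * (Real.exp (2 * ε) - 1) * ‖V‖ ∧
        (2 ≤ n → 1 ≤ d →
          ((convForward Q K V k T δ ε).time : ℝ) ≤ C * (k * n * d * Real.log n)) := by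
  -- `4000` from `convForward_time` times `4` from `natLog_two_add_one_le`.
  refine ⟨16000, by norm_num, ?_⟩
  intro n d k T δ ε Q K V b m hclose hm0 hδ
  have hsep := hclose.isSeparated hδ
  obtain ⟨hb, R, -, hR, -⟩ := hclose
  have hε : 0 ≤ ε := (norm_nonneg R).trans hR
  have hfst := fst_le_of_mem_recover Q K k T δ ε
  have hAB : ∀ i j, |attnMatrix Q K i j - basisMatrix (recover Q K k T δ ε).val i j|
      ≤ (Real.exp (2 * ε) - 1) * attnMatrix Q K i j := by
    intro i j
    rw [attnMatrix_apply]
    split_ifs with hji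
    · obtain ⟨p, hpj, hmax, hval⟩ := basisMatrix_recover Q K hsep hε hb.one_le_k
        (by rw [hm0 _ rfl, Nat.sub_self]) (Fin.le_def.1 hji)
      rw [hval, ← score_sub (maskedScores Q K) (Fin.le_def.1 hji)]
      refine abs_exp_sub_exp_le ?_
      -- Column `j` and the column at position `p` approximate the same sum at the same distance
      -- from the diagonal, so their entries differ by at most `2 * ε`.
      have h1 := hsep.close j ((i : ℕ) - j) (by omega)
      have h2 := hsep.close (n - m p) ((i : ℕ) - j) (by omega)
      rw [hsep.filter_eq_Iic hpj hmax] at h1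
      rw [hsep.filter_eq_Iic le_rfl fun q hq => hmax q (hq.trans hpj)] at h2
      rw [abs_le] at h1 h2 ⊢
      constructor <;> linarith
    · rw [basisMatrix_of_lt (by omega)]
      simp
  have hB0 : ∀ i j, 0 ≤ basisMatrix (recover Q K k T δ ε).val i j := by
    intro i j
    rcases Nat.lt_or_ge i j with hij | hji
    · exact (basisMatrix_of_lt hij _).ge
    · obtain ⟨p, -, -, hval⟩ := basisMatrix_recover Q K hsep hε hb.one_le_k
        (by rw [hm0 _ rfl, Nat.sub_self]) hji
      rw [hval]
      positivity
  have hB : ∀ i, 0 < ∑ j, basisMatrix (recover Q K k T δ ε).val i j := by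
    intro i
    refine Finset.sum_pos' (fun j _ => hB0 i j) ⟨i, Finset.mem_univ _, ?_⟩
    obtain ⟨p, -, -, hval⟩ := basisMatrix_recover Q K hsep hε hb.one_le_k
      (by rw [hm0 _ rfl, Nat.sub_self]) (le_refl (i : ℕ))
    rw [hval]
    positivity
  refine ⟨fun i => ?_, ?_, fun hn hd => ?_⟩
  · rw [approxNormalizer_val _ hfst]
    simpa [Matrix.mulVec, dotProduct] using (hB i).ne'
  · have hexp : 1 ≤ Real.exp (2 * ε) := Real.one_le_exp (by linarith)
    refine (Matrix.norm_le_iff (mul_nonneg (by linarith) (norm_nonneg V))).2 fun i c => ?_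
    rw [Matrix.sub_apply, exactAttention_apply, convForward_val _ _ _ _ _ _ _ hfst]
    exact abs_weighted_average_sub_le (attnMatrix_sum_pos Q K i) (hB i) (hB0 i) (hAB i)
      (fun j => Matrix.norm_entry_le_entrywise_sup_norm V) (norm_nonneg V)
  · have h1 := convForward_time Q K V δ ε (Nat.lt_pow_succ_log_self one_lt_two n) hb.T_le
      (Nat.le_add_left 1 _) (by omega) hd hb.one_le_k
    have h2 := natLog_two_add_one_le hn
    calc ((convForward Q K V k T δ ε).time : ℝ)
        ≤ ((4000 * (k * n * d * (Nat.log 2 n + 1)) : ℕ) : ℝ) := by exact_mod_cast h1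
      _ = 4000 * (k * n * d * ((Nat.log 2 n + 1 : ℕ) : ℝ)) := by push_cast; ring
      _ ≤ 4000 * (k * n * d * (4 * Real.log n)) := by gcongr
      _ = 16000 * (k * n * d * Real.log n) := by ring
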